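/- Let $n\ge 2$ with $n-1\equiv 0\pmod 8$. Let $E$ be a Euclidean space of dimension $n-1$ with inner product $(\cdot,\cdot)$, and let $\mathfrak m=E\oplus\mathbb R p\oplus\mathbb R q$ be Minkowski space with scalar product $\langle\cdot,\cdot\rangle$ given by $\langle e,f\rangle=-(e,f)$ for $e,f\in E$, $p,q$ isotropic and orthogonal to $E$, $\langle p,q\rangle=1$. Clifford algebras are taken with the convention $v^2=-\langle v,v\rangle$. Write $e^\flat=\langle e,\cdot\rangle\in E^*$. Let $b$ be a non-degenerate symmetric bilinear form on $E$, let $B\in\mathrm{End}(E)$ be defined by $b(e,f)=-\langle Be,f\rangle$, and let $\mathfrak{heis}_b=E^*+E+\mathbb R p$ be the Lie algebra whose only non-trivial brackets are $[e^\flat,f]=b(e,f)\,p=-[f,e^\flat]$. Let $S_0$ be an irreducible real $\mathrm{Cl}(E)$-module and let $S=S_0\oplus S_0$ (columns) be the irreducible $\mathrm{Cl}(\mathfrak m)$-module on which $e\in E$, $p$, $q$ act by $$\begin{pmatrix}-e&0\\0&e\end{pmatrix},\qquad \begin{pmatrix}0&2\sqrt2\\0&0\end{pmatrix},\qquad \begin{pmatrix}0&0\\-\tfrac1{\sqrt2}&0\end{pmatrix}.$$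 A Lie algebra representation $\rho:\mathfrak{heis}_b\to\mathfrak{gl}_{\mathbb R}(S)$ is called spin if, for all $e\in E$, $\rho(e^\flat)$ is the action on $S$ of $\tfrac14(p\cdot Be-Be\cdot p)\in\mathrm{Cl}(\mathfrak m)$; it has non-zero charge if $\rho(p)\neq0$. The Schur algebra is the algebra of real endomorphisms of $S_0$ that commute with all $\tfrac14(vw-wv)$, $v,w\in E$ (the action of $\mathfrak{so}(E)$). A para-complex structure is an endomorphism with square $\mathrm{Id}$ whose $\pm1$-eigenspaces have equal dimension. For linear maps $\rho_{11},\rho_{22},\rho_{12}:E\to\mathrm{End}_{\mathbb R}(S_0)$, call $\rho_{12}$ $(\rho_{11},\rho_{22})$-suitable if $(e,f)\mapsto\rho_{11}(e)\rho_{12}(f)-\rho_{12}(f)\rho_{22}(e)$ is symmetric. Then the volume element $e_1\cdots e_{n-1}$ of any orthonormal basis of $E$ acts on $S_0$ as a para-complex structure belonging to the Schur algebra. Moreover, let $\mathcal E$ be any para-complex structure in the Schur algebra. For every spin representation $\rho$ of $\mathfrak{heis}_b$ of non-zero charge there are a sign $\pm$, a real number $h_1\ne0$, a linear form $h_3\in\mathrm{Hom}_{\mathbb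 R}(E,\mathbb R)$ and a linear map $\rho_{12}:E\to\mathrm{End}_{\mathbb R}(S_0)$ such that $$\rho(p)=\sqrt2\begin{pmatrix}0&h_1(\mathrm{Id}\pm \mathcal E)\\0&0\end{pmatrix},\qquad \rho(e)=\begin{pmatrix}\rho_{11}(e)&\rho_{12}(e)\\0&\rho_{22}(e)\end{pmatrix}\quad(e\in E),$$ where $$\rho_{11}(e)=\tfrac12\bigl(h_3(e)\mathrm{Id}-h_1e\pm h_1e\,\mathcal E\bigr),\qquad \rho_{22}(e)=\tfrac12\bigl(h_3(e)\mathrm{Id}+h_1e\pm h_1e\,\mathcal E\bigr)$$ (the same sign throughout), and $\rho_{12}$ is $(\rho_{11},\rho_{22})$-suitable. Conversely, for every sign $\pm$, every real $h_1\neq0$, every linear form $h_3$ and every $(\rho_{11},\rho_{22})$-suitable map $\rho_{12}$, these formulas define exactly one spin representation of $\mathfrak{heis}_b$, and it has non-zero charge. -/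

import Mathlib

-- the commutator bracket on associative rings, here on `𝔤𝔩(S) = End(S)`
attribute [local instance 100] LieRing.ofAssociativeRing

namespace CahenWallach

noncomputable section

section Euclidean

variable (E : Type*) [NormedAddCommGroup E] [InnerProductSpace ℝ E]

/-- The negative definite scalar product `⟨·,·⟩` on the Euclidean summand `E` of Minkowski space:
minus the (positive) inner product of `E`. -/
def scalarE : LinearMap.BilinForm ℝ E := -(innerₗ E)

/-- Minkowski space `𝔪 = E ⊕ ℝ𝔭 ⊕ ℝ𝔮`; the triple `(e, s, t)` is `e + s𝔭 + t𝔮`. -/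
abbrev Minkowski : Type _ := E × ℝ × ℝ

/-- The scalar product of Minkowski space: it is `scalarE` on `E`, the vectors `𝔭, 𝔮` are isotropic
and orthogonal to `E`, and `⟨𝔭, 𝔮⟩ = 1`. -/
def scalarM : LinearMap.BilinForm ℝ (Minkowski E) :=
  LinearMap.mk₂ ℝ
    (fun v w => scalarE E v.1 w.1 + v.2.1 * w.2.2 + v.2.2 * w.2.1)
    (by intros; simp; ring) (by intros; simp; ring)
    (by intros; simp; ring) (by intros; simp; ring)

/-- The Clifford algebra `Cl(E)` with the convention `v² = -⟨v, v⟩`. -/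
abbrev ClE : Type _ := CliffordAlgebra (-(scalarE E).toQuadraticMap)

/-- The Clifford algebra `Cl(𝔪)` with the convention `v² = -⟨v, v⟩`. -/
abbrev ClM : Type _ := CliffordAlgebra (-(scalarM E).toQuadraticMap)

variable {E}

/-- The canonical inclusion `E → Cl(E)`. -/
abbrev ιE : E →ₗ[ℝ] ClE E := CliffordAlgebra.ι _

/-- The canonical inclusion `𝔪 → Cl(𝔪)`. -/
abbrev ιM : Minkowski E →ₗ[ℝ] ClM E := CliffordAlgebra.ι _

/-- The image `¼[v, w] ∈ Cl(E)` of `v ∧ w = ⟨v,·⟩w - ⟨w,·⟩v ∈ 𝔰𝔬(E)`. -/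
def wedgeE (v w : E) : ClE E := (1 / 4 : ℝ) • (ιE v * ιE w - ιE w * ιE v)

/-- The image `¼[v, w] ∈ Cl(𝔪)` of `v ∧ w = ⟨v,·⟩w - ⟨w,·⟩v ∈ 𝔰𝔬(𝔪)`. -/
def wedgeM (v w : Minkowski E) : ClM E := (1 / 4 : ℝ) • (ιM v * ιM w - ιM w * ιM v)

/-- The volume element `ω = e₁ ⋯ e_m ∈ Cl(E)` of an orthonormal basis of `E`. -/
def volumeElement {m : ℕ} (e : OrthonormalBasis (Fin m) ℝ E) : ClE E :=
  (List.ofFn fun i => ιE (e i)).prod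

theorem scalarE_apply (v w : E) : scalarE E v w = -(inner ℝ v w) := rfl

theorem scalarE_nondegenerate : (scalarE E).Nondegenerate := by
  constructor <;> intro v hv
  · simpa [scalarE_apply] using hv v
  · simpa [scalarE_apply] using hv v

end Euclidean

section Heisenberg

variable {E : Type*} [NormedAddCommGroup E] [InnerProductSpace ℝ E] [FiniteDimensional ℝ E]

/-- The musical isomorphism `e ↦ e^♭ = ⟨e, ·⟩`. -/
def flat : E ≃ₗ[ℝ] Module.Dual ℝ E :=
  LinearMap.BilinForm.toDual (scalarE E) scalarE_nondegenerate

/-- The endomorphism `B` of `E` with `b(v, w) = -⟨Bv, w⟩`. -/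
def opB (b : LinearMap.BilinForm ℝ E) : E →ₗ[ℝ] E :=
  -(flat.symm.toLinearMap ∘ₗ b)

/-- The underlying space of the Heisenberg algebra `𝔥𝔢𝔦𝔰_b = E^* + E + ℝ𝔭`;
the triple `(α, e, s)` is `α + e + s𝔭`. -/
def Heis (_b : LinearMap.BilinForm ℝ E) : Type _ := Module.Dual ℝ E × E × ℝ

variable (b : LinearMap.BilinForm ℝ E)

instance : AddCommGroup (Heis b) := inferInstanceAs (AddCommGroup (Module.Dual ℝ E × E × ℝ))

instance : Module ℝ (Heis b) := inferInstanceAs (Module ℝ (Module.Dual ℝ E × E × ℝ))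

/-- The inclusion `E^* → 𝔥𝔢𝔦𝔰_b`. -/
def Heis.ofDual : Module.Dual ℝ E →ₗ[ℝ] Heis b :=
  LinearMap.inl ℝ (Module.Dual ℝ E) (E × ℝ)

/-- The inclusion `E → 𝔥𝔢𝔦𝔰_b`. -/
def Heis.ofE : E →ₗ[ℝ] Heis b :=
  LinearMap.inr ℝ (Module.Dual ℝ E) (E × ℝ) ∘ₗ LinearMap.inl ℝ E ℝ

/-- The central element `𝔭` of `𝔥𝔢𝔦𝔰_b`. -/
def Heis.p : Heis b := ((0, 0, 1) : Module.Dual ℝ E × E × ℝ)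

/-- The only non-trivial brackets are `[e^♭, f] = b(e, f)𝔭 = -[f, e^♭]`. -/
instance : Bracket (Heis b) (Heis b) where
  bracket x y := (b (flat.symm x.1) y.2.1 - b (flat.symm y.1) x.2.1) • Heis.p b

theorem Heis.bracket_def (x y : Heis b) :
    ⁅x, y⁆ = (b (flat.symm x.1) y.2.1 - b (flat.symm y.1) x.2.1) • Heis.p b := rfl

theorem Heis.add_fst (x y : Heis b) : (x + y).1 = x.1 + y.1 := rfl
theorem Heis.add_mid (x y : Heis b) : (x + y).2.1 = x.2.1 + y.2.1 := rfl
theorem Heis.smul_fst (r : ℝ) (x : Heis b) : (r • x).1 = r • x.1 := rfl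
theorem Heis.smul_mid (r : ℝ) (x : Heis b) : (r • x).2.1 = r • x.2.1 := rfl
theorem Heis.p_fst : (Heis.p b).1 = 0 := rfl
theorem Heis.p_mid : (Heis.p b).2.1 = 0 := rfl

instance : LieRing (Heis b) where
  add_lie x y z := by
    simp only [Heis.bracket_def, Heis.add_fst, Heis.add_mid, map_add, LinearMap.add_apply]
    module
  lie_add x y z := by
    simp only [Heis.bracket_def, Heis.add_fst, Heis.add_mid, map_add, LinearMap.add_apply]
    module
  lie_self x := by simp [Heis.bracket_def]
  leibniz_lie x y z := by
    simp [Heis.bracket_def, Heis.smul_fst, Heis.smul_mid, Heis.p_fst, Heis.p_mid]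

instance : LieAlgebra ℝ (Heis b) where
  lie_smul r x y := by
    simp only [Heis.bracket_def, Heis.smul_fst, Heis.smul_mid, map_smul, LinearMap.smul_apply,
      smul_eq_mul]
    module

end Heisenberg

section Spin

variable {E : Type*} [NormedAddCommGroup E] [InnerProductSpace ℝ E]
variable (S₀ : Type*) [AddCommGroup S₀] [Module ℝ S₀] [Module (ClE E) S₀]
  [IsScalarTower ℝ (ClE E) S₀]

/-- Clifford action of `Cl(E)` on the module `S₀`, by `ℝ`-linear endomorphisms. -/
def cliff : ClE E →ₐ[ℝ] Module.End ℝ S₀ := Algebra.lsmul ℝ ℝ S₀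

/-- Clifford multiplication by vectors of `E`. -/
def vec : E →ₗ[ℝ] Module.End ℝ S₀ := (cliff S₀).toLinearMap ∘ₗ ιE

variable (E) in
/-- The Schur algebra: the endomorphisms of `S₀` that commute with the action of `𝔰𝔬(E)`. -/
def schurAlgebra : Subalgebra ℝ (Module.End ℝ S₀) :=
  Subalgebra.centralizer ℝ {A | ∃ v w : E, A = cliff S₀ (wedgeE v w)}

variable {S₀}

/-- A para-complex structure on a real vector space: an involution whose eigenspaces for `1` and
`-1` have the same dimension. -/
def IsParaComplex (A : Module.End ℝ S₀) : Prop :=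
  A * A = 1 ∧ Module.rank ℝ (A.eigenspace 1) = Module.rank ℝ (A.eigenspace (-1))

/-- The endomorphism of `S₀ × S₀` with the block matrix `(a₁₁ a₁₂ ; a₂₁ a₂₂)`, acting on columns
`(Q₋, Q₊)`. -/
def block (a₁₁ a₁₂ a₂₁ a₂₂ : Module.End ℝ S₀) : Module.End ℝ (S₀ × S₀) :=
  (a₁₁.coprod a₁₂).prod (a₂₁.coprod a₂₂)

variable (S₀) in
/-- Clifford multiplication by vectors of `𝔪` on `S = S₋ + S₊ = S₀ × S₀`: on
`S_{1,1} ⊗ S₀` (graded tensor product), in the basis `𝔭/(2√2), 1` of `S_{1,1} = Λ(ℝ𝔭)`, the vector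
`𝔭` acts by exterior multiplication, `𝔮` by minus the interior multiplication with `𝔮(𝔭) = 2`, and
`e ∈ E` by Clifford multiplication with the sign of the grading. -/
def vecM : Minkowski E →ₗ[ℝ] Module.End ℝ (S₀ × S₀) where
  toFun v := block (-(vec S₀ v.1)) ((2 * √2 * v.2.1) • 1) (-(v.2.2 / √2) • 1) (vec S₀ v.1)
  map_add' v w := by
    ext x <;> simp [block] <;> module
  map_smul' r v := by
    ext x <;> simp [block] <;> module

theorem vec_vec (v : E) (x : S₀) : vec S₀ v (vec S₀ v x) = (inner ℝ v v : ℝ) • x := by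
  have h : vec S₀ v * vec S₀ v = algebraMap ℝ _ (inner ℝ v v : ℝ) := by
    simp only [vec, LinearMap.comp_apply, AlgHom.toLinearMap_apply, ← map_mul,
      CliffordAlgebra.ι_sq_scalar, AlgHom.commutes]
    simp [scalarE_apply]
  exact congrArg (fun A : Module.End ℝ S₀ => A x) h

theorem vecM_sq (v : Minkowski E) :
    vecM S₀ v * vecM S₀ v =
      algebraMap ℝ (Module.End ℝ (S₀ × S₀)) ((-(scalarM E).toQuadraticMap) v) := by
  have h2 : (√2 : ℝ) * (√2)⁻¹ = 1 := mul_inv_cancel₀ (by positivity)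
  have h : 2 * √2 * v.2.1 * (v.2.2 / √2) = 2 * v.2.1 * v.2.2 := by
    rw [div_eq_mul_inv]; linear_combination (2 * v.2.1 * v.2.2) * h2
  have hq : (-(scalarM E).toQuadraticMap) v = inner ℝ v.1 v.1 - 2 * v.2.1 * v.2.2 := by
    simp [scalarM, scalarE_apply]; ring
  rw [hq]
  refine LinearMap.ext fun x => Prod.ext ?_ ?_
  · rw [Module.algebraMap_end_apply]
    simp [vecM, block, vec_vec, smul_smul]
    rw [h]; module
  · rw [Module.algebraMap_end_apply]
    simp [vecM, block, vec_vec, smul_smul]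
    rw [mul_comm (v.2.2 / √2), h]; module

variable (S₀) in
/-- The spin representation `ρ_spin : Cl(𝔪) → End(S)`, on `S = S₀ × S₀`. -/
def spinRep : ClM E →ₐ[ℝ] Module.End ℝ (S₀ × S₀) :=
  CliffordAlgebra.lift _ ⟨vecM S₀, vecM_sq⟩

/-- The spin module `S = S₀ × S₀` is an irreducible `Cl(𝔪)`-module when `S₀` is an irreducible
`Cl(E)`-module. -/
theorem spinRep_irreducible [IsSimpleModule (ClE E) S₀] (W : Submodule ℝ (S₀ × S₀))
    (hW : ∀ (c : ClM E), ∀ x ∈ W, spinRep S₀ c x ∈ W) : W = ⊥ ∨ W = ⊤ := by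
  have hv : ∀ (v : Minkowski E), ∀ x ∈ W, vecM S₀ v x ∈ W := fun v x hx => by
    have := hW (ιM v) x hx
    simpa [spinRep, CliffordAlgebra.lift_ι_apply] using this
  have s2 : (√2:ℝ) ≠ 0 := by positivity
  have hp : ∀ x ∈ W, ((x.2, 0) : S₀ × S₀) ∈ W := fun x hx => by
    have := W.smul_mem (2 * √2)⁻¹ (hv (0, 1, 0) x hx)
    have h1 : (√2)⁻¹ * 2⁻¹ * (2 * √2) = (1 : ℝ) := by field_simp
    simpa [vecM, block, smul_smul, h1] using this
  have hq : ∀ x ∈ W, ((0, x.1) : S₀ × S₀) ∈ W := fun x hx => by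
    have := W.smul_mem (-√2) (hv (0, 0, 1) x hx)
    simpa [vecM, block, smul_smul, s2] using this
  let U : Submodule (ClE E) S₀ :=
    { carrier := {y | ((0, y) : S₀ × S₀) ∈ W}
      zero_mem' := W.zero_mem
      add_mem' := fun {a b} ha hb => by simpa using W.add_mem ha hb
      smul_mem' := fun c y hy => by
        induction c using CliffordAlgebra.induction generalizing y with
        | algebraMap r =>
          have := W.smul_mem r hy
          simpa [algebraMap_smul] using this
        | ι v =>
          have := hv (v, 0, 0) _ hy
          simpa [vecM, block, vec, cliff] using this
        | mul a b ha hb => rw [mul_smul]; exact ha _ (hb _ hy)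
        | add a b ha hb =>
          rw [add_smul]
          have := W.add_mem (ha _ hy) (hb _ hy)
          simpa using this }
  rcases eq_bot_or_eq_top U with h | h
  · left
    rw [eq_bot_iff]
    intro x hx
    have h1 : x.1 ∈ U := hq x hx
    have h2 : x.2 ∈ U := hq _ (hp x hx)
    rw [h] at h1 h2
    exact Prod.ext h1 h2
  · right
    rw [eq_top_iff]
    intro x _
    have h1 : x.1 ∈ U := by rw [h]; trivial
    have h2 : x.2 ∈ U := by rw [h]; trivial
    have := W.add_mem (hp _ h1) h2
    simpa using this

/-- `ρ₁₂` is `(ρ₁₁, ρ₂₂)`-suitable: the bilinear map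
`(e, f) ↦ ρ₁₁(e) ∘ ρ₁₂(f) - ρ₁₂(f) ∘ ρ₂₂(e)` is symmetric. -/
def IsSuitable (ρ₁₁ ρ₂₂ ρ₁₂ : E →ₗ[ℝ] Module.End ℝ S₀) : Prop :=
  ∀ e f : E, ρ₁₁ e * ρ₁₂ f - ρ₁₂ f * ρ₂₂ e = ρ₁₁ f * ρ₁₂ e - ρ₁₂ e * ρ₂₂ f

variable [FiniteDimensional ℝ E] {b : LinearMap.BilinForm ℝ E}

/-- A representation of `𝔥𝔢𝔦𝔰_b` on `S` is spin if `e^♭` acts as the element `𝔭 ∧ Be` of `𝔰𝔬(𝔪)`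
does in the spin representation. -/
def IsSpin (ρ : Heis b →ₗ⁅ℝ⁆ Module.End ℝ (S₀ × S₀)) : Prop :=
  ∀ e : E, ρ (Heis.ofDual b (flat e)) = spinRep S₀ (wedgeM (0, 1, 0) (opB b e, 0, 0))

/-- The diagonal blocks `e ↦ ½ (h₃(e) Id + c e + s e𝓔)`, where `e𝓔` is `𝓔` followed by Clifford
multiplication by `e`. -/
def diagBlock (𝓔 : Module.End ℝ S₀) (c s : ℝ) (h₃ : Module.Dual ℝ E) :
    E →ₗ[ℝ] Module.End ℝ S₀ :=
  (1 / 2 : ℝ) • (h₃.smulRight 1 + c • vec S₀ + s • (LinearMap.mulRight ℝ 𝓔 ∘ₗ vec S₀))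

end Spin

end

end CahenWallach

/-! Group an orthonormal basis of `E` into blocks of eight. The words of a direct sum of extended
Hamming codes then index monomials of `Cl(E)` which are commuting involutions, as the code is doubly
even and self-dual, and so they have a common eigenvector `x ∈ S₀`. By self-duality every monomial
commuting with all of them is, up to sign, one of them, whence an endomorphism commuting with
`Cl(E)` maps `x` to a multiple of itself. So only scalars commute with `Cl(E)`, and an element of
the Schur algebra has the form `α + β ω` with `ω` the volume element; a para-complex structure has
`α = 0` and anticommutes with Clifford multiplication.

For non-degenerate `b`, the spin condition turns the relation `[e^♭, v] = b(e, v) 𝔭` into the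
statement that the bracket of `√2 (0 u ; 0 0)` with `ρ(v)` is `(u, v) ρ(𝔭)` for all `u, v ∈ E`. This
forces `ρ(v) = (A(v) C(v) ; 0 F(v))` and `ρ(𝔭) = √2 (0 K ; 0 0)` with `u F(v) - A(v) u = (u, v) K`.
Then `u K u` is the same for all members `u` of an orthonormal basis, which gives `K = c + s 𝓔` and
determines `F` and `A` up to `α(v) ± β(v) 𝓔`. As `𝔭` is central, `β = 0` and `c² = s²`. -/

namespace CahenWallach

section CliffordFamilies

variable {A ι : Type*} [Ring A] {c : ι → A}

/-- A Clifford family: pairwise anticommuting elements of square `1`, that is, generators of a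
positive definite Clifford algebra in an arbitrary ring. -/
structure IsCliffordFamily (c : ι → A) : Prop where
  mul_self : ∀ i, c i * c i = 1
  anticomm : ∀ i j, i ≠ j → c i * c j = -(c j * c i)

/-- The monomial `c_{i₁} ⋯ c_{iₙ}` of the word `i₁ ⋯ iₙ`. -/
def monomial (c : ι → A) (w : List ι) : A := (w.map c).prod

theorem monomial_cons (i : ι) (w : List ι) : monomial c (i :: w) = c i * monomial c w := by
  simp [monomial]

theorem monomial_append (v w : List ι) :
    monomial c (v ++ w) = monomial c v * monomial c w := by
  simp [monomial]

theorem IsCliffordFamily.mul_mul_self (hc : IsCliffordFamily c) (i : ι) (x : A) :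
    c i * (c i * x) = x := by
  rw [← mul_assoc, hc.mul_self, one_mul]

theorem IsCliffordFamily.monomial_reverse_mul (hc : IsCliffordFamily c) (w : List ι) :
    monomial c w.reverse * monomial c w = 1 := by
  induction w with
  | nil => simp [monomial]
  | cons i w ih =>
    have hi : monomial c [i] = c i := by simp [monomial]
    rw [List.reverse_cons, monomial_append, mul_assoc, hi, monomial_cons, hc.mul_mul_self, ih]

theorem IsCliffordFamily.monomial_perm (hc : IsCliffordFamily c) {v w : List ι} (h : v.Perm w) :
    monomial c v = monomial c w ∨ monomial c v = -monomial c w := by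
  induction h with
  | nil => exact .inl rfl
  | cons i _ ih =>
    simp only [monomial_cons]
    exact ih.imp (by rw [·]) (by rw [·, mul_neg])
  | swap i j w =>
    simp only [monomial_cons, ← mul_assoc]
    obtain rfl | hij := eq_or_ne i j
    · exact .inl rfl
    · exact .inr (by rw [hc.anticomm j i hij.symm, neg_mul])
  | trans _ _ ih₁ ih₂ =>
    rcases ih₁ with h₁ | h₁ <;> rcases ih₂ with h₂ | h₂ <;> simp [h₁, h₂]

section Parity

variable [DecidableEq ι]

theorem IsCliffordFamily.mul_monomial (hc : IsCliffordFamily c) (i : ι) (w : List ι) :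
    c i * monomial c w = (-1 : ℤ) ^ (w.length + w.count i) • (monomial c w * c i) := by
  induction w with
  | nil => simp [monomial]
  | cons j w ih =>
    rw [monomial_cons, mul_assoc, List.length_cons]
    obtain rfl | hij := eq_or_ne i j
    · rw [ih, mul_smul_comm, List.count_cons_self, add_add_add_comm, pow_add _ _ (1 + 1),
        one_add_one_eq_two, neg_one_sq, mul_one]
    · rw [← mul_assoc, hc.anticomm i j hij, neg_mul, mul_assoc, ih, mul_smul_comm,
        List.count_cons_of_ne hij.symm, add_right_comm, pow_succ, mul_neg_one, neg_smul]

theorem IsCliffordFamily.monomial_mul_monomial (hc : IsCliffordFamily c) (v w : List ι) :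
    monomial c v * monomial c w =
      (-1 : ℤ) ^ (v.length * w.length + (v.map w.count).sum) • (monomial c w * monomial c v) := by
  induction v with
  | nil => simp [monomial]
  | cons i v ih =>
    rw [monomial_cons, mul_assoc, ih, mul_smul_comm, ← mul_assoc, hc.mul_monomial, smul_mul_assoc,
      smul_smul, ← pow_add, mul_assoc, List.length_cons, List.map_cons, List.sum_cons]
    congr 2
    ring

/-- The letters of a word counted modulo two, as a binary vector. -/
def parity (w : List ι) : ι → ZMod 2 := fun i => w.count i

theorem parity_append (v w : List ι) : parity (v ++ w) = parity v + parity w := by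
  ext i
  simp [parity]

theorem parity_reverse (w : List ι) : parity w.reverse = parity w := by
  ext i
  simp [parity]

theorem IsCliffordFamily.monomial_of_parity_eq_zero (hc : IsCliffordFamily c) (w : List ι)
    (hw : parity w = 0) : monomial c w = 1 ∨ monomial c w = -1 := by
  induction hn : w.length using Nat.strong_induction_on generalizing w with
  | _ n ih =>
    cases w with
    | nil => exact .inl rfl
    | cons i v =>
      have hi : i ∈ v := by
        by_contra hi
        have := congrFun hw i
        simp [parity, List.count_eq_zero.2 hi] at this
      have hperm : (i :: v).Perm (i :: i :: v.erase i) := (List.perm_cons_erase hi).cons i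
      have hparity : parity (v.erase i) = 0 := by
        have h : parity (i :: v) = parity [i] + parity [i] + parity (v.erase i) := by
          rw [← parity_append, ← parity_append]
          exact funext fun j => congrArg Nat.cast (hperm.count_eq j)
        rwa [hw, ZModModule.add_self, zero_add, eq_comm] at h
      have hlen := List.length_erase_of_mem hi
      have hlt : (v.erase i).length < n := by rw [← hn, List.length_cons]; omega
      have hmon : monomial c (i :: i :: v.erase i) = monomial c (v.erase i) := by
        rw [monomial_cons, monomial_cons, hc.mul_mul_self]
      rcases hmon ▸ hc.monomial_perm hperm with h | h <;>
        rcases ih _ hlt _ hparity rfl with h' | h' <;> simp [h, h']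

theorem IsCliffordFamily.monomial_eq_or_eq_neg (hc : IsCliffordFamily c) {v w : List ι}
    (h : parity v = parity w) : monomial c v = monomial c w ∨ monomial c v = -monomial c w := by
  have hvw : parity (v ++ w.reverse) = 0 := by
    rw [parity_append, parity_reverse, h, ZModModule.add_self]
  have hv : monomial c v = monomial c (v ++ w.reverse) * monomial c w := by
    rw [monomial_append, mul_assoc, hc.monomial_reverse_mul, mul_one]
  rw [hv]
  exact (hc.monomial_of_parity_eq_zero _ hvw).imp (by rw [·, one_mul]) (by rw [·, neg_one_mul])

variable [Fintype ι]

theorem sum_map_count_eq_dotProduct_parity (v w : List ι) :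
    ((v.map w.count).sum : ZMod 2) = parity v ⬝ᵥ parity w := by
  induction v with
  | nil => simp [parity, dotProduct]
  | cons i v ih =>
    have h : parity [i] = Pi.single i 1 := by
      ext j
      by_cases hj : i = j <;> simp [parity, hj, eq_comm]
    rw [← List.singleton_append (l := v), parity_append, add_dotProduct, ← ih, h,
      single_dotProduct]
    simp [parity]

theorem IsCliffordFamily.monomial_mul_monomial_of_even (hc : IsCliffordFamily c) (v : List ι)
    {w : List ι} (hw : Even w.length) : monomial c v * monomial c w =
      (-1 : ℤ) ^ (parity v ⬝ᵥ parity w).val • (monomial c w * monomial c v) := by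
  rw [hc.monomial_mul_monomial, ← sum_map_count_eq_dotProduct_parity, ZMod.val_natCast,
    ← neg_one_pow_eq_pow_mod_two, pow_add, (hw.mul_left _).neg_one_pow, one_mul]

end Parity

theorem IsCliffordFamily.monomial_mul_monomial_eq_or_eq_neg (hc : IsCliffordFamily c)
    (v w : List ι) : monomial c v * monomial c w = monomial c w * monomial c v ∨
      monomial c v * monomial c w = -(monomial c w * monomial c v) := by
  classical
  rw [hc.monomial_mul_monomial]
  obtain h | h := neg_one_pow_eq_or ℤ (v.length * w.length + (v.map w.count).sum) <;> simp [h]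

theorem IsCliffordFamily.monomial_mul_self (hc : IsCliffordFamily c) {w : List ι}
    (hw : w.Nodup) : monomial c w * monomial c w = (-1 : ℤ) ^ w.length.choose 2 • 1 := by
  classical
  induction w with
  | nil => simp [monomial]
  | cons i w ih =>
    obtain ⟨hi, hw⟩ := List.nodup_cons.1 hw
    rw [monomial_cons]
    nth_rw 1 [hc.mul_monomial]
    rw [List.count_eq_zero.2 hi, add_zero, smul_mul_assoc, mul_assoc, hc.mul_mul_self, ih hw,
      smul_smul, ← pow_add, List.length_cons, Nat.choose_succ_succ', Nat.choose_one_right]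

theorem IsCliffordFamily.monomial_mul_self_of_four_dvd (hc : IsCliffordFamily c) {w : List ι}
    (hw : w.Nodup) (h4 : 4 ∣ w.length) : monomial c w * monomial c w = 1 := by
  obtain ⟨k, hk⟩ := h4
  have hchoose : (4 * k).choose 2 = 2 * (k * (4 * k - 1)) := by
    rw [Nat.choose_two_right, show 4 * k * (4 * k - 1) = 2 * (2 * (k * (4 * k - 1))) by ring,
      Nat.mul_div_cancel_left _ two_pos]
  rw [hc.monomial_mul_self hw, hk, hchoose, pow_mul, neg_one_sq, one_pow, one_smul]

end CliffordFamilies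

section BinaryCodes

variable {ι : Type*} [Fintype ι]

/-- A binary linear code which is equal to its dual and all of whose words have weight divisible
by four. -/
structure IsDoublyEvenSelfDual (C : Submodule (ZMod 2) (ι → ZMod 2)) : Prop where
  mem_iff : ∀ t, t ∈ C ↔ ∀ u ∈ C, t ⬝ᵥ u = 0
  four_dvd : ∀ t ∈ C, 4 ∣ hammingNorm t

/-- The systematic generator matrix of the extended Hamming code of length eight. The code is
self-dual, so that this is also a parity check matrix. -/
def hammingMatrix : Matrix (Fin 4) (Fin 8) (ZMod 2) :=
  !![1, 0, 0, 0, 0, 1, 1, 1;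
     0, 1, 0, 0, 1, 0, 1, 1;
     0, 0, 1, 0, 1, 1, 0, 1;
     0, 0, 0, 1, 1, 1, 1, 0]

open Matrix

theorem hammingMatrix_mulVec_row (r : Fin 4) : hammingMatrix *ᵥ hammingMatrix r = 0 := by
  revert r; decide

theorem eq_vecMul_of_hammingMatrix_mulVec_eq_zero :
    ∀ t : Fin 8 → ZMod 2, hammingMatrix *ᵥ t = 0 →
      t = (fun r : Fin 4 => t (r.castLE (by norm_num))) ᵥ* hammingMatrix := by
  decide +kernel

theorem four_dvd_hammingNorm_of_hammingMatrix_mulVec_eq_zero :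
    ∀ t : Fin 8 → ZMod 2, hammingMatrix *ᵥ t = 0 → 4 ∣ hammingNorm t := by
  decide +kernel

variable (κ : Type*) [Fintype κ]

/-- The direct sum of copies of the extended Hamming code. -/
def hammingCode : Submodule (ZMod 2) (κ × Fin 8 → ZMod 2) where
  carrier := {t | ∀ k, hammingMatrix *ᵥ (fun i => t (k, i)) = 0}
  zero_mem' _ := mulVec_zero _
  add_mem' {t u} ht hu k :=
    (mulVec_add hammingMatrix (fun i => t (k, i)) (fun i => u (k, i))).trans
      (by rw [ht k, hu k, add_zero])
  smul_mem' r t ht k :=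
    (mulVec_smul hammingMatrix r (fun i => t (k, i))).trans (by rw [ht k, smul_zero])

theorem isDoublyEvenSelfDual_hammingCode : IsDoublyEvenSelfDual (hammingCode κ) where
  mem_iff t := by
    classical
    refine ⟨fun ht u hu => ?_, fun ht k => funext fun r => ?_⟩
    · rw [dotProduct, Fintype.sum_prod_type]
      refine Finset.sum_eq_zero fun k _ => ?_
      change (fun i => t (k, i)) ⬝ᵥ (fun i => u (k, i)) = 0
      rw [eq_vecMul_of_hammingMatrix_mulVec_eq_zero _ (ht k), ← dotProduct_mulVec, hu k,
        dotProduct_zero]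
    · let row : κ × Fin 8 → ZMod 2 := fun p => if p.1 = k then hammingMatrix r p.2 else 0
      have hrow : row ∈ hammingCode κ := fun l => by
        by_cases hl : l = k
        · simpa only [row, hl, if_true] using hammingMatrix_mulVec_row r
        · simp only [row, hl, if_false]
          exact mulVec_zero hammingMatrix
      have h := ht row hrow
      simpa [dotProduct, Fintype.sum_prod_type, row, mulVec, mul_comm] using h
  four_dvd t ht := by
    have h : hammingNorm t = ∑ k, hammingNorm fun i => t (k, i) := by
      simp only [hammingNorm, Finset.card_filter, Fintype.sum_prod_type]
    rw [h]
    exact Finset.dvd_sum fun k _ =>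
      four_dvd_hammingNorm_of_hammingMatrix_mulVec_eq_zero _ (ht k)

end BinaryCodes

section Commutant

open Module

/-- Only the scalars commute with every member of the family: for the generators of an algebra
acting irreducibly, this says that the representation is of real type. -/
def HasScalarCommutant {ι A : Type*} (K : Type*) [CommSemiring K] [Ring A] [Algebra K A]
    (c : ι → A) : Prop :=
  ∀ X, (∀ i, Commute X (c i)) → ∃ r : K, X = r • 1

theorem exists_ne_zero_forall_apply_eq_or_eq_neg {R V : Type*} [CommRing R] [AddCommGroup V]
    [Module R V] [Nontrivial V] {U : Set (End R V)} (hU : U.Finite)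
    (hcomm : ∀ u ∈ U, ∀ v ∈ U, Commute u v) (hsq : ∀ u ∈ U, u * u = 1) :
    ∃ x ≠ 0, ∀ u ∈ U, u x = x ∨ u x = -x := by
  induction U, hU using Set.Finite.induction_on with
  | empty => simpa using exists_ne (0 : V)
  | @insert u U _ _ ih =>
    obtain ⟨x, hx, hUx⟩ := ih (fun v hv w hw => hcomm v (.inr hv) w (.inr hw))
      fun v hv => hsq v (.inr hv)
    obtain h | h := eq_or_ne (x + u x) 0
    · exact ⟨x, hx, Set.forall_mem_insert.2 ⟨.inr (eq_neg_of_add_eq_zero_right h), hUx⟩⟩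
    · refine ⟨x + u x, h, Set.forall_mem_insert.2 ⟨.inl ?_, fun v hv => ?_⟩⟩
      · rw [map_add, ← End.mul_apply, hsq u (.inl rfl), End.one_apply, add_comm]
      · have hvu : v (u x) = u (v x) :=
          LinearMap.congr_fun (hcomm v (.inr hv) u (.inl rfl)) x
        rw [map_add, hvu]
        refine (hUx v hv).imp (fun hv => by rw [hv]) fun hv => ?_
        rw [hv, map_neg, neg_add]

variable {K V : Type*} [Field K] [NeZero (2 : K)] [AddCommGroup V] [Module K V]

theorem mem_span_apply_setOf_commute {u : End K V} {G : Set (End K V)}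
    (hG : ∀ g ∈ G, u * g = g * u ∨ u * g = -(g * u)) {x y : V}
    (hxy : (u x = x ∧ u y = y) ∨ (u x = -x ∧ u y = -y))
    (hy : y ∈ Submodule.span K ((· x) '' G)) :
    y ∈ Submodule.span K ((· x) '' {g ∈ G | Commute u g}) := by
  obtain ⟨χ, hχ, hx, huy⟩ : ∃ χ : K, χ * χ = 1 ∧ u x = χ • x ∧ u y = χ • y := by
    rcases hxy with ⟨hx, hy⟩ | ⟨hx, hy⟩
    · exact ⟨1, by simp [hx, hy]⟩
    · exact ⟨-1, by simp [hx, hy]⟩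
  have hproj : Submodule.span K ((· x) '' G) ≤
      (Submodule.span K ((· x) '' {g ∈ G | Commute u g})).comap (1 + χ • u) := by
    refine Submodule.span_le.2 (Set.image_subset_iff.2 fun g hg => ?_)
    have hgx : u (g x) = χ • g x ∧ Commute u g ∨ u (g x) = -(χ • g x) := by
      refine (hG g hg).imp (fun h => ⟨?_, h⟩) fun h => ?_
      · rw [← End.mul_apply, h, End.mul_apply, hx, map_smul]
      · rw [← End.mul_apply, h, LinearMap.neg_apply, End.mul_apply, hx, map_smul]
    simp only [Set.mem_preimage, SetLike.mem_coe, Submodule.mem_comap, LinearMap.add_apply,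
      End.one_apply, LinearMap.smul_apply]
    rcases hgx with ⟨h, hug⟩ | h
    · rw [h, smul_smul, hχ, one_smul]
      have hgx : g x ∈ Submodule.span K ((· x) '' {g ∈ G | Commute u g}) :=
        Submodule.subset_span ⟨g, ⟨hg, hug⟩, rfl⟩
      exact add_mem hgx hgx
    · rw [h, smul_neg, smul_smul, hχ, one_smul, add_neg_cancel]
      exact zero_mem _
  have h2 : (2 : K) • y ∈ Submodule.span K ((· x) '' {g ∈ G | Commute u g}) := by
    have h : (1 + χ • u) y = (2 : K) • y := by
      rw [LinearMap.add_apply, End.one_apply, LinearMap.smul_apply, huy, smul_smul, hχ, one_smul,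
        two_smul]
    exact h ▸ hproj hy
  exact (Submodule.smul_mem_iff _ two_ne_zero).1 h2

theorem mem_span_apply_setOf_forall_commute {U : Set (End K V)} (hU : U.Finite)
    {G : Set (End K V)} (hG : ∀ u ∈ U, ∀ g ∈ G, u * g = g * u ∨ u * g = -(g * u)) {x y : V}
    (hxy : ∀ u ∈ U, (u x = x ∧ u y = y) ∨ (u x = -x ∧ u y = -y))
    (hy : y ∈ Submodule.span K ((· x) '' G)) :
    y ∈ Submodule.span K ((· x) '' {g ∈ G | ∀ u ∈ U, Commute u g}) := by
  induction U, hU using Set.Finite.induction_on with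
  | empty => simpa using hy
  | @insert u U _ _ ih =>
    rw [Set.forall_mem_insert] at hG hxy
    have h := mem_span_apply_setOf_commute (fun g hg => hG.1 g hg.1) hxy.1 (ih hG.2 hxy.2)
    simpa only [Set.mem_ofPred_eq, Set.forall_mem_insert, and_assoc, and_comm (a := Commute u _)]
      using h

/-- The word without repetitions, in some order, formed by the support of a binary vector. -/
noncomputable def supportWord {ι : Type*} [Fintype ι] (t : ι → ZMod 2) : List ι :=
  ({i | t i ≠ 0} : Finset ι).toList

section SupportWord

variable {ι : Type*} [Fintype ι]

theorem length_supportWord (t : ι → ZMod 2) : (supportWord t).length = hammingNorm t :=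
  Finset.length_toList _

theorem nodup_supportWord (t : ι → ZMod 2) : (supportWord t).Nodup :=
  Finset.nodup_toList _

theorem parity_supportWord [DecidableEq ι] (t : ι → ZMod 2) : parity (supportWord t) = t := by
  ext i
  have hi : i ∈ supportWord t ↔ t i ≠ 0 := by simp [supportWord]
  have hone : ∀ a : ZMod 2, a ≠ 0 → a = 1 := by decide
  rw [parity, (nodup_supportWord t).count]
  by_cases h : t i = 0
  · simp [hi, h]
  · simp [hi, hone _ h]

theorem IsCliffordFamily.monomial_supportWord_mul_self {A : Type*} [Ring A] {c : ι → A}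
    (hc : IsCliffordFamily c) {t : ι → ZMod 2} (ht : 4 ∣ hammingNorm t) :
    monomial c (supportWord t) * monomial c (supportWord t) = 1 :=
  hc.monomial_mul_self_of_four_dvd (nodup_supportWord t) (length_supportWord t ▸ ht)

end SupportWord

theorem IsCliffordFamily.dotProduct_parity_eq_zero_of_commute {ι A : Type*} [Fintype ι]
    [DecidableEq ι] [Ring A] [Nontrivial A] [Algebra K A] {c : ι → A} (hc : IsCliffordFamily c)
    {v w : List ι} (hw : Even w.length) (hvw : Commute (monomial c v) (monomial c w)) :
    parity v ⬝ᵥ parity w = 0 := by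
  by_contra h
  have hone : ∀ a : ZMod 2, a ≠ 0 → a.val = 1 := by decide
  have hanti := hc.monomial_mul_monomial_of_even v hw
  rw [hone _ h, pow_one, neg_one_smul, ← hvw.eq, eq_neg_iff_add_eq_zero, ← two_smul K,
    ← monomial_append] at hanti
  have hzero := (smul_eq_zero.1 hanti).resolve_left two_ne_zero
  have := hc.monomial_reverse_mul (v ++ w)
  rw [hzero, mul_zero] at this
  exact zero_ne_one this

theorem adjoin_range_eq_span_range_monomial {ι R A : Type*} [CommSemiring R] [Ring A]
    [Algebra R A] (c : ι → A) :
    Subalgebra.toSubmodule (Algebra.adjoin R (Set.range c)) =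
      Submodule.span R (Set.range (monomial c)) := by
  have h : (Submonoid.closure (Set.range c) : Set A) = Set.range (monomial c) := by
    rw [← FreeMonoid.mrange_lift]
    ext
    simp [FreeMonoid.lift_apply, monomial, FreeMonoid.toList.surjective.exists]
  rw [Algebra.adjoin_eq_span, h]

theorem commute_monomial {ι A : Type*} [Ring A] {c : ι → A} {X : A} (hX : ∀ i, Commute X (c i))
    (w : List ι) : Commute X (monomial c w) :=
  Commute.list_prod_right _ _ (List.forall_mem_map.2 fun i _ => hX i)

section SelfDual

variable {ι : Type*} [Fintype ι] {C : Submodule (ZMod 2) (ι → ZMod 2)}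

theorem IsDoublyEvenSelfDual.even_length_supportWord (hC : IsDoublyEvenSelfDual C)
    {t : ι → ZMod 2} (ht : t ∈ C) : Even (supportWord t).length := by
  rw [length_supportWord]
  exact even_iff_two_dvd.2 (dvd_trans (by norm_num) (hC.four_dvd t ht))

theorem IsCliffordFamily.commute_monomial_supportWord {A : Type*} [Ring A] {c : ι → A}
    (hc : IsCliffordFamily c) (hC : IsDoublyEvenSelfDual C) {t u : ι → ZMod 2} (ht : t ∈ C)
    (hu : u ∈ C) : Commute (monomial c (supportWord t)) (monomial c (supportWord u)) := by
  classical
  have h := hc.monomial_mul_monomial_of_even (supportWord t) (hC.even_length_supportWord hu)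
  rwa [parity_supportWord, parity_supportWord, (hC.mem_iff t).1 ht u hu, ZMod.val_zero,
    pow_zero, one_smul] at h

variable [Nontrivial V] {c : ι → End K V}

theorem IsCliffordFamily.monomial_apply_mem_span_singleton (hc : IsCliffordFamily c)
    (hC : IsDoublyEvenSelfDual C) {x : V}
    (hx : ∀ t ∈ C, monomial c (supportWord t) x = x ∨ monomial c (supportWord t) x = -x)
    {w : List ι} (hw : ∀ t ∈ C, Commute (monomial c (supportWord t)) (monomial c w)) :
    monomial c w x ∈ K ∙ x := by
  classical
  have hmem : parity w ∈ C := by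
    refine (hC.mem_iff _).2 fun t ht => ?_
    rw [← parity_supportWord t]
    exact hc.dotProduct_parity_eq_zero_of_commute (K := K) (hC.even_length_supportWord ht)
      (hw t ht).symm
  have hx' : monomial c (supportWord (parity w)) x ∈ K ∙ x := by
    have hself := Submodule.mem_span_singleton_self (R := K) x
    rcases hx _ hmem with h | h <;> rw [h]
    exacts [hself, neg_mem hself]
  rcases hc.monomial_eq_or_eq_neg (parity_supportWord (parity w)).symm with h | h <;> rw [h]
  exacts [hx', neg_mem hx']

theorem IsCliffordFamily.exists_hasEigenvector_of_commute (hc : IsCliffordFamily c)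
    (hC : IsDoublyEvenSelfDual C)
    (hirr : ∀ x ≠ 0, ∀ y, ∃ a ∈ Algebra.adjoin K (Set.range c), a x = y) {X : End K V}
    (hX : ∀ i, Commute X (c i)) : ∃ r x, X.HasEigenvector r x := by
  set U : Set (End K V) := (fun t => monomial c (supportWord t)) '' C
  have hUfin : U.Finite := (C : Set (ι → ZMod 2)).toFinite.image _
  obtain ⟨x, hx, hUx⟩ : ∃ x ≠ 0, ∀ u ∈ U, u x = x ∨ u x = -x := by
    refine exists_ne_zero_forall_apply_eq_or_eq_neg hUfin ?_ ?_
    · rintro _ ⟨t, ht, rfl⟩ _ ⟨t', ht', rfl⟩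
      exact hc.commute_monomial_supportWord hC ht ht'
    · rintro _ ⟨t, ht, rfl⟩
      exact hc.monomial_supportWord_mul_self (hC.four_dvd t ht)
  have hspan : X x ∈ Submodule.span K ((· x) '' Set.range (monomial c)) := by
    obtain ⟨a, ha, hax⟩ := hirr x hx (X x)
    rw [← Subalgebra.mem_toSubmodule, adjoin_range_eq_span_range_monomial] at ha
    exact hax ▸ Submodule.apply_mem_span_image_of_mem_span (LinearMap.applyₗ x) ha
  have hXx : X x ∈ K ∙ x := by
    refine Submodule.span_le.2 ?_ (mem_span_apply_setOf_forall_commute hUfin ?_ ?_ hspan)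
    · rintro _ ⟨_, ⟨⟨w, rfl⟩, hw⟩, rfl⟩
      exact hc.monomial_apply_mem_span_singleton hC (fun t ht => hUx _ ⟨t, ht, rfl⟩)
        fun t ht => hw _ ⟨t, ht, rfl⟩
    · rintro _ ⟨t, -, rfl⟩ _ ⟨w, rfl⟩
      exact hc.monomial_mul_monomial_eq_or_eq_neg _ w
    · rintro _ ⟨t, ht, rfl⟩
      have hXu : X (monomial c (supportWord t) x) = monomial c (supportWord t) (X x) :=
        LinearMap.congr_fun (commute_monomial hX _) x
      refine (hUx _ ⟨t, ht, rfl⟩).imp (fun h => ⟨h, ?_⟩) fun h => ⟨h, ?_⟩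
      · rw [← hXu, h]
      · rw [← hXu, h, map_neg]
  obtain ⟨r, hr⟩ := Submodule.mem_span_singleton.1 hXx
  exact ⟨r, x, End.mem_eigenspace_iff.2 hr.symm, hx⟩

theorem IsCliffordFamily.hasScalarCommutant (hc : IsCliffordFamily c)
    (hC : IsDoublyEvenSelfDual C)
    (hirr : ∀ x ≠ 0, ∀ y, ∃ a ∈ Algebra.adjoin K (Set.range c), a x = y) :
    HasScalarCommutant K c := by
  intro X hX
  obtain ⟨r, x, hr, hx⟩ := hc.exists_hasEigenvector_of_commute hC hirr hX
  refine ⟨r, LinearMap.ext fun y => ?_⟩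
  obtain ⟨a, ha, rfl⟩ := hirr x hx y
  have hXa : Commute X a :=
    Algebra.commute_of_mem_adjoin_of_forall_mem_commute ha (by rintro _ ⟨i, rfl⟩; exact hX i)
  rw [← End.mul_apply, hXa.eq, End.mul_apply, End.mem_eigenspace_iff.1 hr, map_smul]
  rfl

end SelfDual

end Commutant

section Grading

variable {ι K A : Type*} [Field K] [NeZero (2 : K)] [Ring A] [Algebra K A] {c : ι → A} {ε : A}

/-- A grading operator of a family: an involution which anticommutes with all its members. -/
structure IsGradingOperator (c : ι → A) (ε : A) : Prop where
  mul_self : ε * ε = 1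
  anticomm : ∀ i, c i * ε = -(ε * c i)

theorem IsGradingOperator.comp (hε : IsGradingOperator c ε) {κ : Type*} (f : κ → ι) :
    IsGradingOperator (fun k => c (f k)) ε :=
  ⟨hε.mul_self, fun k => hε.anticomm (f k)⟩

theorem IsGradingOperator.commute_mul (hε : IsGradingOperator c ε) {X : A} {i : ι}
    (hX : c i * X = -(X * c i)) : Commute (X * ε) (c i) := by
  rw [Commute, SemiconjBy, mul_assoc, ← neg_neg (ε * c i), ← hε.anticomm i, mul_neg, ← mul_assoc,
    ← neg_mul, ← hX, mul_assoc]

theorem IsGradingOperator.smul_one_add_smul_eq_zero [Nontrivial A] (hε : IsGradingOperator c ε)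
    (hc : IsCliffordFamily c) (i : ι) {r t : K} (h : r • (1 : A) + t • ε = 0) :
    r = 0 ∧ t = 0 := by
  have hsub : r • (1 : A) - t • ε = 0 := by
    have hconj : c i * ε * c i = -ε := by
      rw [hε.anticomm, neg_mul, mul_assoc, hc.mul_self, mul_one]
    have := congrArg (fun z => c i * z * c i) h
    simpa only [mul_add, add_mul, mul_smul_comm, smul_mul_assoc, mul_one, hc.mul_self, hconj,
      smul_neg, mul_zero, zero_mul, ← sub_eq_add_neg] using this
  have hr : r = 0 := by
    have h2 : (2 * r) • (1 : A) = 0 := calc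
      _ = (r • 1 + t • ε) + (r • 1 - t • ε) := by module
      _ = 0 := by rw [h, hsub, add_zero]
    simpa [two_ne_zero] using h2
  have hε0 : ε ≠ 0 := fun h0 => one_ne_zero (by rw [← hε.mul_self, h0, mul_zero] : (1 : A) = 0)
  rw [hr, zero_smul, zero_add] at h
  exact ⟨hr, (smul_eq_zero_iff_left hε0).1 h⟩

theorem IsGradingOperator.exists_eq_smul_one_add_smul (hε : IsGradingOperator c ε)
    (hc : IsCliffordFamily c) (hcent : HasScalarCommutant K c) {X Y : A}
    (hX : ∀ i, c i * X * c i = Y) :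
    ∃ α β : K, X = α • 1 + β • ε ∧ Y = α • 1 - β • ε := by
  have hXY : ∀ i, c i * X = Y * c i := fun i => by
    rw [← hX i, mul_assoc _ (c i), hc.mul_self, mul_one]
  have hYX : ∀ i, c i * Y = X * c i := fun i => by
    rw [← hX i, mul_assoc, hc.mul_mul_self]
  obtain ⟨α, hα⟩ := hcent (X + Y) fun i => by
    rw [Commute, SemiconjBy, add_mul, mul_add, hXY, hYX, add_comm]
  obtain ⟨β, hβ⟩ := hcent ((X - Y) * ε) fun i => hε.commute_mul (by
    rw [sub_mul, mul_sub, hXY, hYX, neg_sub])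
  have hsub : X - Y = β • ε := by
    rw [← mul_one (X - Y), ← hε.mul_self, ← mul_assoc, hβ, smul_mul_assoc, one_mul]
  have h2 : (2⁻¹ : K) * 2 = 1 := inv_mul_cancel₀ two_ne_zero
  have htwo (Z : A) : Z = (2⁻¹ : K) • (Z + Z) := by
    rw [← two_smul K, smul_smul, h2, one_smul]
  refine ⟨2⁻¹ * α, 2⁻¹ * β, ?_, ?_⟩
  · rw [htwo X, mul_smul, mul_smul, ← hα, ← hsub, ← smul_add]
    congr 1
    abel
  · rw [htwo Y, mul_smul, mul_smul, ← hα, ← hsub, ← smul_sub]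
    congr 1
    abel

end Grading

section CliffordModule

variable {E : Type*} [NormedAddCommGroup E] [InnerProductSpace ℝ E]
variable (S₀ : Type*) [AddCommGroup S₀] [Module ℝ S₀] [Module (ClE E) S₀]
  [IsScalarTower ℝ (ClE E) S₀]

theorem vec_mul_self (v : E) : vec S₀ v * vec S₀ v = (inner ℝ v v : ℝ) • 1 :=
  LinearMap.ext (vec_vec v)

theorem vec_mul_vec_add_swap (v w : E) :
    vec S₀ v * vec S₀ w + vec S₀ w * vec S₀ v = (2 * inner ℝ v w : ℝ) • 1 := calc
  _ = vec S₀ (v + w) * vec S₀ (v + w) - vec S₀ v * vec S₀ v - vec S₀ w * vec S₀ w := by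
    rw [map_add]
    noncomm_ring
  _ = (2 * inner ℝ v w : ℝ) • 1 := by
    simp only [vec_mul_self, ← sub_smul, real_inner_add_add_self]
    congr 1
    ring

theorem isCliffordFamily_vec {ι : Type*} {e : ι → E} (he : Orthonormal ℝ e) :
    IsCliffordFamily fun i => vec S₀ (e i) where
  mul_self i := by rw [vec_mul_self, real_inner_self_eq_norm_sq, he.norm_eq_one, one_pow, one_smul]
  anticomm i j hij := by
    rw [eq_neg_iff_add_eq_zero, vec_mul_vec_add_swap, he.inner_eq_zero hij, mul_zero, zero_smul]

section Irreducible

variable {ι : Type*} [Fintype ι] (e : OrthonormalBasis ι ℝ E)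

theorem cliff_mem_adjoin (a : ClE E) :
    cliff S₀ a ∈ Algebra.adjoin ℝ (Set.range fun i => vec S₀ (e i)) := by
  induction a using CliffordAlgebra.induction with
  | algebraMap r => exact (cliff (E := E) S₀).commutes r ▸ Subalgebra.algebraMap_mem _ r
  | ι v =>
    change vec (E := E) S₀ v ∈ Algebra.adjoin ℝ (Set.range fun i => vec S₀ (e i))
    rw [← e.sum_repr v, map_sum]
    refine sum_mem fun i _ => ?_
    rw [map_smul]
    exact Subalgebra.smul_mem _ (Algebra.subset_adjoin (Set.mem_range_self i)) _
  | mul a b ha hb => exact map_mul (cliff S₀) a b ▸ mul_mem ha hb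
  | add a b ha hb => exact map_add (cliff S₀) a b ▸ add_mem ha hb

theorem hasScalarCommutant_vec [IsSimpleModule (ClE E) S₀] (hι : 8 ∣ Fintype.card ι) :
    HasScalarCommutant ℝ fun i => vec S₀ (e i) := by
  have : Nontrivial S₀ := IsSimpleModule.nontrivial (ClE E) S₀
  obtain ⟨k, hk⟩ := hι
  let σ : ι ≃ Fin k × Fin 8 := Fintype.equivOfCardEq (by simp [hk, mul_comm])
  have h := (isCliffordFamily_vec S₀ (e.reindex σ).orthonormal).hasScalarCommutant (K := ℝ)
    (isDoublyEvenSelfDual_hammingCode (Fin k)) fun x hx y => by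
      obtain ⟨a, ha⟩ := IsSimpleModule.toSpanSingleton_surjective (ClE E) hx y
      exact ⟨cliff S₀ a, cliff_mem_adjoin S₀ (e.reindex σ) a, ha⟩
  exact fun X hX => h X fun p => by simpa using hX (σ.symm p)

end Irreducible

theorem cliff_volumeElement {m : ℕ} (e : OrthonormalBasis (Fin m) ℝ E) :
    cliff S₀ (volumeElement e) = monomial (fun i => vec S₀ (e i)) (List.finRange m) := by
  rw [volumeElement, map_list_prod, List.ofFn_eq_map, List.map_map]
  rfl

variable {S₀}

theorem isGradingOperator_vec_of_basis {ι : Type*} [Fintype ι] {e : OrthonormalBasis ι ℝ E}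
    {ε : Module.End ℝ S₀} (hε : IsGradingOperator (fun i => vec S₀ (e i)) ε) :
    IsGradingOperator (vec (E := E) S₀) ε where
  mul_self := hε.mul_self
  anticomm v := by
    have h : LinearMap.mulRight ℝ ε ∘ₗ vec S₀ = -(LinearMap.mulLeft ℝ ε ∘ₗ vec S₀) :=
      e.toBasis.ext fun i => by simpa using hε.anticomm i
    exact LinearMap.congr_fun h v

variable (S₀) in
theorem isGradingOperator_cliff_volumeElement {m : ℕ} (hm : 4 ∣ m)
    (e : OrthonormalBasis (Fin m) ℝ E) :
    IsGradingOperator (vec (E := E) S₀) (cliff S₀ (volumeElement e)) := by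
  have hc := isCliffordFamily_vec S₀ e.orthonormal
  have heven : Even m := even_iff_two_dvd.2 (dvd_trans (by norm_num) hm)
  refine isGradingOperator_vec_of_basis (e := e) ⟨?_, fun i => ?_⟩ <;> rw [cliff_volumeElement]
  · exact hc.monomial_mul_self_of_four_dvd (List.nodup_finRange m) (by rwa [List.length_finRange])
  · rw [hc.mul_monomial, List.length_finRange,
      (List.nodup_finRange m).count, if_pos (List.mem_finRange i),
      heven.add_one.neg_one_pow, neg_one_smul]

theorem cliff_wedgeE (v w : E) : cliff S₀ (wedgeE v w) =
    (1 / 4 : ℝ) • (vec S₀ v * vec S₀ w - vec S₀ w * vec S₀ v) := by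
  simp only [wedgeE, map_smul, map_sub, map_mul]
  rfl

theorem IsGradingOperator.mem_schurAlgebra {ε : Module.End ℝ S₀}
    (hε : IsGradingOperator (vec (E := E) S₀) ε) : ε ∈ schurAlgebra E S₀ := by
  rw [schurAlgebra, Subalgebra.mem_centralizer_iff]
  rintro _ ⟨v, w, rfl⟩
  have hcomm (v w : E) : vec S₀ v * vec S₀ w * ε = ε * (vec S₀ v * vec S₀ w) := by
    rw [mul_assoc, hε.anticomm w, mul_neg, ← mul_assoc, hε.anticomm v, neg_mul, neg_neg, mul_assoc]
  rw [cliff_wedgeE, smul_mul_assoc, mul_smul_comm, sub_mul, mul_sub, hcomm, hcomm]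

theorem vec_mul_mul_vec_of_mem_schurAlgebra {X : Module.End ℝ S₀} (hX : X ∈ schurAlgebra E S₀)
    {ι : Type*} {e : ι → E} (he : Orthonormal ℝ e) (i j : ι) :
    vec S₀ (e i) * X * vec S₀ (e i) = vec S₀ (e j) * X * vec S₀ (e j) := by
  obtain rfl | hij := eq_or_ne i j
  · rfl
  have hc := isCliffordFamily_vec S₀ he
  have hcomm : X * (vec S₀ (e i) * vec S₀ (e j)) = vec S₀ (e i) * vec S₀ (e j) * X := by
    have h := (Subalgebra.mem_centralizer_iff ℝ).1 hX _ ⟨e i, e j, rfl⟩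
    rw [cliff_wedgeE, hc.anticomm j i hij.symm, sub_neg_eq_add, ← two_smul ℝ, smul_smul,
      smul_mul_assoc, mul_smul_comm] at h
    exact (smul_right_injective _ (by norm_num) h).symm
  calc vec S₀ (e i) * X * vec S₀ (e i)
      = vec S₀ (e i) * (X * (vec S₀ (e i) * vec S₀ (e j))) * vec S₀ (e j) := by
        simp only [mul_assoc, hc.mul_self, mul_one]
    _ = vec S₀ (e j) * X * vec S₀ (e j) := by
        rw [hcomm]
        simp only [mul_assoc]
        rw [hc.mul_mul_self]

end CliffordModule

section ParaComplex

variable {V : Type*} [AddCommGroup V] [Module ℝ V]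

theorem isParaComplex_of_anticommute {X Y : Module.End ℝ V} (hX : X * X = 1) (hY : Y * Y = 1)
    (h : Y * X = -(X * Y)) : IsParaComplex X := by
  have hYY : Function.LeftInverse Y Y := LinearMap.congr_fun hY
  have hrank (r : ℝ) : Module.rank ℝ (X.eigenspace r) ≤ Module.rank ℝ (X.eigenspace (-r)) := by
    have hmap : ∀ x ∈ X.eigenspace r, Y x ∈ X.eigenspace (-r) := fun x hx => by
      rw [Module.End.mem_eigenspace_iff] at hx ⊢
      have hYX := LinearMap.congr_fun h x
      rw [Module.End.mul_apply, LinearMap.neg_apply, Module.End.mul_apply, hx, map_smul] at hYX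
      rw [neg_smul, hYX, neg_neg]
    exact LinearMap.rank_le_of_injective (Y.restrict hmap) fun x y hxy =>
      Subtype.ext (hYY.injective (congrArg Subtype.val hxy))
  exact ⟨hX, le_antisymm (hrank 1) ((hrank (-1)).trans_eq (by rw [neg_neg]))⟩

theorem IsParaComplex.neg {X : Module.End ℝ V} (hX : IsParaComplex X) : IsParaComplex (-X) := by
  have h (r : ℝ) : (-X).eigenspace r = X.eigenspace (-r) := by
    ext x
    rw [Module.End.mem_eigenspace_iff, Module.End.mem_eigenspace_iff, LinearMap.neg_apply,
      neg_smul, neg_eq_iff_eq_neg]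
  exact ⟨by rw [neg_mul_neg, hX.1], by rw [h, h, neg_neg, hX.2]⟩

theorem IsParaComplex.ne_one [Nontrivial V] {X : Module.End ℝ V} (hX : IsParaComplex X) :
    X ≠ 1 := by
  rintro rfl
  have : IsAddTorsionFree V := .of_isTorsionFree ℝ V
  have htop : (1 : Module.End ℝ V).eigenspace 1 = ⊤ := by
    ext x
    simp
  have hbot : (1 : Module.End ℝ V).eigenspace (-1) = ⊥ := by
    ext x
    rw [Module.End.mem_eigenspace_iff, Module.End.one_apply, neg_one_smul, self_eq_neg,
      Submodule.mem_bot]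
  have h := hX.2
  rw [htop, hbot, rank_top, rank_bot] at h
  exact rank_pos.ne' h

theorem IsParaComplex.ne_smul_one [Nontrivial V] {X : Module.End ℝ V} (hX : IsParaComplex X)
    (r : ℝ) : X ≠ r • 1 := by
  rintro rfl
  have hr : (r * r) • (1 : Module.End ℝ V) = (1 : ℝ) • 1 := by
    simpa only [smul_mul_smul_comm, one_smul, mul_one] using hX.1
  obtain rfl | rfl := mul_self_eq_one_iff.1 (smul_left_injective ℝ one_ne_zero hr)
  · exact hX.ne_one (one_smul ℝ 1)
  · exact hX.neg.ne_one (by rw [neg_one_smul, neg_neg])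

end ParaComplex

section GradingOperator

variable {E : Type*} [NormedAddCommGroup E] [InnerProductSpace ℝ E]
variable {S₀ : Type*} [AddCommGroup S₀] [Module ℝ S₀] [Module (ClE E) S₀]
  [IsScalarTower ℝ (ClE E) S₀]

theorem IsGradingOperator.isParaComplex {ι : Type*} [Nonempty ι] {c : ι → Module.End ℝ S₀}
    (hc : IsCliffordFamily c) {ε : Module.End ℝ S₀} (hε : IsGradingOperator c ε) :
    IsParaComplex ε :=
  isParaComplex_of_anticommute hε.mul_self (hc.mul_self (Classical.arbitrary ι)) (hε.anticomm _)

theorem isParaComplex_cliff_volumeElement {m : ℕ} [NeZero m] (hm : 4 ∣ m)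
    (e : OrthonormalBasis (Fin m) ℝ E) : IsParaComplex (cliff S₀ (volumeElement e)) :=
  ((isGradingOperator_cliff_volumeElement S₀ hm e).comp e).isParaComplex
    (isCliffordFamily_vec S₀ e.orthonormal)

theorem IsParaComplex.isGradingOperator_of_mem_schurAlgebra [IsSimpleModule (ClE E) S₀] {m : ℕ}
    [NeZero m] (hm : 8 ∣ m) (e : OrthonormalBasis (Fin m) ℝ E) {X : Module.End ℝ S₀}
    (hX : IsParaComplex X) (hmem : X ∈ schurAlgebra E S₀) :
    IsGradingOperator (vec (E := E) S₀) X := by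
  have : Nontrivial S₀ := IsSimpleModule.nontrivial (ClE E) S₀
  set ω := cliff S₀ (volumeElement e)
  have hω : IsGradingOperator (vec (E := E) S₀) ω :=
    isGradingOperator_cliff_volumeElement S₀ (dvd_trans (by norm_num) hm) e
  have hc := isCliffordFamily_vec S₀ e.orthonormal
  obtain ⟨α, β, hαβ, -⟩ := (hω.comp e).exists_eq_smul_one_add_smul hc
    (hasScalarCommutant_vec S₀ e (by rwa [Fintype.card_fin]))
    (fun i => vec_mul_mul_vec_of_mem_schurAlgebra hmem e.orthonormal i 0)
  have hβ : β ≠ 0 := by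
    rintro rfl
    exact hX.ne_smul_one α (by rw [hαβ, zero_smul, add_zero])
  have hsq : (α * α + β * β - 1) • (1 : Module.End ℝ S₀) + (2 * (α * β)) • ω = 0 := by
    have h := hX.1
    rw [hαβ] at h
    simp only [mul_add, add_mul, smul_mul_smul_comm, one_mul, mul_one, hω.mul_self] at h
    rw [← sub_eq_zero] at h
    rw [← h]
    module
  have hα : α = 0 := by
    have := ((hω.comp e).smul_one_add_smul_eq_zero hc 0 hsq).2
    simpa [hβ] using this
  have hX' : X = β • ω := by rw [hαβ, hα, zero_smul, zero_add]
  exact ⟨hX.1, fun v => by rw [hX', mul_smul_comm, hω.anticomm, smul_neg, smul_mul_assoc]⟩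

end GradingOperator

section Blocks

variable {V : Type*} [AddCommGroup V] [Module ℝ V]

theorem block_mul (a b c d a' b' c' d' : Module.End ℝ V) :
    block a b c d * block a' b' c' d' =
      block (a * a' + b * c') (a * b' + b * d') (c * a' + d * c') (c * b' + d * d') := by
  refine LinearMap.ext fun x => Prod.ext ?_ ?_ <;> simp [block] <;> abel

theorem block_sub (a b c d a' b' c' d' : Module.End ℝ V) :
    block a b c d - block a' b' c' d' = block (a - a') (b - b') (c - c') (d - d') := by
  refine LinearMap.ext fun x => Prod.ext ?_ ?_ <;> simp [block] <;> abel

theorem block_add (a b c d a' b' c' d' : Module.End ℝ V) :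
    block a b c d + block a' b' c' d' = block (a + a') (b + b') (c + c') (d + d') := by
  refine LinearMap.ext fun x => Prod.ext ?_ ?_ <;> simp [block] <;> abel

theorem smul_block (r : ℝ) (a b c d : Module.End ℝ V) :
    r • block a b c d = block (r • a) (r • b) (r • c) (r • d) := by
  refine LinearMap.ext fun x => Prod.ext ?_ ?_ <;> simp [block]

theorem block_zero : block (0 : Module.End ℝ V) 0 0 0 = 0 := by
  refine LinearMap.ext fun x => Prod.ext ?_ ?_ <;> simp [block]

theorem block_inj {a b c d a' b' c' d' : Module.End ℝ V} :
    block a b c d = block a' b' c' d' ↔ a = a' ∧ b = b' ∧ c = c' ∧ d = d' := by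
  refine ⟨fun h => ?_, by rintro ⟨rfl, rfl, rfl, rfl⟩; rfl⟩
  have h₁ : ∀ x, block a b c d (x, 0) = block a' b' c' d' (x, 0) := fun x => by rw [h]
  have h₂ : ∀ x, block a b c d (0, x) = block a' b' c' d' (0, x) := fun x => by rw [h]
  simp only [block, LinearMap.prod_apply, Function.prod_apply, LinearMap.coprod_apply, map_zero,
    add_zero, zero_add, Prod.mk.injEq] at h₁ h₂
  exact ⟨LinearMap.ext fun x => (h₁ x).1, LinearMap.ext fun x => (h₂ x).1,
    LinearMap.ext fun x => (h₁ x).2, LinearMap.ext fun x => (h₂ x).2⟩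

variable {W : Type*} [AddCommGroup W] [Module ℝ W]

/-- The linear family of endomorphisms of `V × V` with the given linear families of blocks. -/
def linearBlock (a b c d : W →ₗ[ℝ] Module.End ℝ V) : W →ₗ[ℝ] Module.End ℝ (V × V) where
  toFun w := block (a w) (b w) (c w) (d w)
  map_add' v w := by simp only [map_add, block_add]
  map_smul' r w := by simp only [map_smul, smul_block, RingHom.id_apply]

theorem linearBlock_apply (a b c d : W →ₗ[ℝ] Module.End ℝ V) (w : W) :
    linearBlock a b c d w = block (a w) (b w) (c w) (d w) := rfl

theorem exists_eq_linearBlock (T : W →ₗ[ℝ] Module.End ℝ (V × V)) :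
    ∃ a b c d : W →ₗ[ℝ] Module.End ℝ V, T = linearBlock a b c d := by
  let entry (f : V × V →ₗ[ℝ] V) (g : V →ₗ[ℝ] V × V) : W →ₗ[ℝ] Module.End ℝ V :=
    LinearMap.lcomp ℝ V g ∘ₗ LinearMap.compRight ℝ f ∘ₗ T
  refine ⟨entry (.fst ℝ V V) (.inl ℝ V V), entry (.fst ℝ V V) (.inr ℝ V V),
    entry (.snd ℝ V V) (.inl ℝ V V), entry (.snd ℝ V V) (.inr ℝ V V),
    LinearMap.ext fun w => LinearMap.ext fun x => ?_⟩
  have hx : T w x = T w (x.1, 0) + T w (0, x.2) := by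
    rw [← map_add, Prod.mk_add_mk, add_zero, zero_add]
  rw [hx]
  rfl

end Blocks

section Heisenberg

variable {E : Type*} [NormedAddCommGroup E] [InnerProductSpace ℝ E] [FiniteDimensional ℝ E]
variable (b : LinearMap.BilinForm ℝ E)

theorem inner_opB (v w : E) : inner ℝ (opB b v) w = b v w := by
  have hflat : flat (opB b v) w = -(inner ℝ (opB b v) w : ℝ) := by
    simp only [flat, LinearMap.BilinForm.toDual_def, scalarE_apply]
  rw [← neg_eq_iff_eq_neg.2 hflat]
  simp [opB]

variable {b} in
theorem opB_surjective (hb : b.Nondegenerate) : Function.Surjective (opB b) := by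
  rw [← LinearMap.injective_iff_surjective, injective_iff_map_eq_zero]
  exact fun v hv => hb.1 v fun w => by rw [← inner_opB, hv, inner_zero_left]

theorem Heis.lie_ofDual_ofE (v w : E) :
    ⁅Heis.ofDual b (flat v), Heis.ofE b w⁆ = b v w • Heis.p b := by
  change (b (flat.symm (flat v)) w - b (flat.symm 0) 0) • Heis.p b = _
  simp

theorem Heis.lie_ofE_ofE (v w : E) : ⁅Heis.ofE b v, Heis.ofE b w⁆ = 0 := by
  change (b (flat.symm 0) w - b (flat.symm 0) v) • Heis.p b = _
  simp

theorem Heis.lie_ofE_p (v : E) : ⁅Heis.ofE b v, Heis.p b⁆ = 0 := by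
  change (b (flat.symm 0) 0 - b (flat.symm 0) v) • Heis.p b = _
  simp

theorem Heis.eq_add_add (x : Heis b) : x =
    Heis.ofDual b (flat (flat.symm x.1)) + Heis.ofE b x.2.1 + x.2.2 • Heis.p b := by
  obtain ⟨α, v, s⟩ := x
  have : ((α, v, s) : Module.Dual ℝ E × E × ℝ) =
      (flat (flat.symm α), 0, 0) + (0, v, 0) + s • (0, 0, 1) := by simp
  exact this

variable {L : Type*} [LieRing L] [LieAlgebra ℝ L]

/-- The linear map on `𝔥𝔢𝔦𝔰_b` given by `u^♭ ↦ D u`, `v ↦ R v` and `𝔭 ↦ P`. -/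
noncomputable def Heis.linearLift (D R : E →ₗ[ℝ] L) (P : L) : Heis b →ₗ[ℝ] L :=
  (D ∘ₗ flat.symm.toLinearMap).coprod (R.coprod (LinearMap.toSpanSingleton ℝ L P))

theorem Heis.linearLift_apply (D R : E →ₗ[ℝ] L) (P : L) (x : Heis b) :
    Heis.linearLift b D R P x = D (flat.symm x.1) + (R x.2.1 + x.2.2 • P) := rfl

theorem Heis.linearLift_p (D R : E →ₗ[ℝ] L) (P : L) :
    Heis.linearLift b D R P (Heis.p b) = P := by
  change D (flat.symm 0) + (R 0 + (1 : ℝ) • P) = P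
  simp

theorem Heis.linearLift_lie {D R : E →ₗ[ℝ] L} {P : L} (hDD : ∀ u v, ⁅D u, D v⁆ = 0)
    (hRR : ∀ u v, ⁅R u, R v⁆ = 0) (hDR : ∀ u v, ⁅D u, R v⁆ = b u v • P)
    (hDP : ∀ u, ⁅D u, P⁆ = 0) (hRP : ∀ v, ⁅R v, P⁆ = 0) (x y : Heis b) :
    Heis.linearLift b D R P ⁅x, y⁆ =
      ⁅Heis.linearLift b D R P x, Heis.linearLift b D R P y⁆ := by
  have hRD (u v : E) : ⁅R v, D u⁆ = -(b u v • P) := by rw [← lie_skew, hDR]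
  have hPD (u : E) : ⁅P, D u⁆ = 0 := by rw [← lie_skew, hDP, neg_zero]
  have hPR (v : E) : ⁅P, R v⁆ = 0 := by rw [← lie_skew, hRP, neg_zero]
  rw [Heis.bracket_def, map_smul, Heis.linearLift_p, Heis.linearLift_apply, Heis.linearLift_apply]
  simp only [add_lie, lie_add, smul_lie, lie_smul, hDD, hRR, hDR, hDP, hRP, hRD, hPD, hPR,
    lie_self]
  module

theorem Heis.existsUnique_lieHom {D R : E →ₗ[ℝ] L} {P : L} (hDD : ∀ u v, ⁅D u, D v⁆ = 0)
    (hRR : ∀ u v, ⁅R u, R v⁆ = 0) (hDR : ∀ u v, ⁅D u, R v⁆ = b u v • P)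
    (hDP : ∀ u, ⁅D u, P⁆ = 0) (hRP : ∀ v, ⁅R v, P⁆ = 0) :
    ∃! ρ : Heis b →ₗ⁅ℝ⁆ L, (∀ u, ρ (Heis.ofDual b (flat u)) = D u) ∧ ρ (Heis.p b) = P ∧
      ∀ v, ρ (Heis.ofE b v) = R v := by
  refine ⟨{ Heis.linearLift b D R P with
    map_lie' := fun {x y} => Heis.linearLift_lie b hDD hRR hDR hDP hRP x y },
    ⟨fun u => ?_, Heis.linearLift_p b D R P, fun v => ?_⟩, ?_⟩
  · change D (flat.symm (flat u)) + (R 0 + (0 : ℝ) • P) = D u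
    simp
  · change D (flat.symm 0) + (R v + (0 : ℝ) • P) = R v
    simp
  · rintro ρ ⟨hD, hP, hR⟩
    refine LieHom.ext fun x => ?_
    change ρ x = D (flat.symm x.1) + (R x.2.1 + x.2.2 • P)
    conv_lhs => rw [Heis.eq_add_add b x]
    rw [map_add, map_add, map_smul, hD, hR, hP, add_assoc]

end Heisenberg

section SpinDatum

variable {E : Type*} [NormedAddCommGroup E] [InnerProductSpace ℝ E]
variable {S₀ : Type*} [AddCommGroup S₀] [Module ℝ S₀] [Module (ClE E) S₀]
  [IsScalarTower ℝ (ClE E) S₀]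

theorem spinRep_wedgeM (u : E) :
    spinRep S₀ (wedgeM (0, 1, 0) (u, 0, 0)) = block 0 (√2 • vec S₀ u) 0 0 := by
  have hι (v : Minkowski E) : spinRep S₀ (ιM v) = vecM S₀ v := by
    rw [spinRep, CliffordAlgebra.lift_ι_apply]
  rw [wedgeM, map_smul, map_sub, map_mul, map_mul, hι, hι]
  simp only [vecM, LinearMap.coe_mk, AddHom.coe_mk, block_mul, block_sub, smul_block, block_inj]
  simp only [map_zero, neg_zero, mul_zero, mul_one, zero_smul, zero_div, zero_mul, add_zero,
    zero_add, sub_zero, smul_zero, smul_mul_assoc, one_mul, mul_smul_comm, mul_neg,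
    true_and, and_true]
  module

/-- The conditions on linear families of blocks `A`, `F`, `C` and an endomorphism `K` under which
`ρ(v) = (A(v) C(v) ; 0 F(v))` for `v ∈ E` and `ρ(𝔭) = √2 (0 K ; 0 0)` define a spin representation
of `𝔥𝔢𝔦𝔰_b`. They do not involve `b`. -/
structure IsSpinDatum (A F C : E →ₗ[ℝ] Module.End ℝ S₀) (K : Module.End ℝ S₀) : Prop where
  commute_left : ∀ u v, Commute (A u) (A v)
  commute_right : ∀ u v, Commute (F u) (F v)
  suitable : IsSuitable A F C
  intertwine : ∀ u v, vec S₀ u * F v - A v * vec S₀ u = (inner ℝ u v : ℝ) • K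
  central : ∀ v, A v * K = K * F v

variable {A F C : E →ₗ[ℝ] Module.End ℝ S₀} {K : Module.End ℝ S₀}

section Correspondence

variable [FiniteDimensional ℝ E] {b : LinearMap.BilinForm ℝ E}

theorem IsSpin.inner_smul_apply_p (hb : b.Nondegenerate)
    {ρ : Heis b →ₗ⁅ℝ⁆ Module.End ℝ (S₀ × S₀)} (hρ : IsSpin ρ) (u v : E) :
    (inner ℝ u v : ℝ) • ρ (Heis.p b) = ⁅block 0 (√2 • vec S₀ u) 0 0, ρ (Heis.ofE b v)⁆ := by
  obtain ⟨w, rfl⟩ := opB_surjective hb u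
  rw [inner_opB, ← map_smul, ← Heis.lie_ofDual_ofE, LieHom.map_lie, hρ w, spinRep_wedgeM]

theorem IsSpin.exists_eq_block {ι : Type*} [Fintype ι] [Nontrivial ι]
    (e : OrthonormalBasis ι ℝ E) (hb : b.Nondegenerate)
    {ρ : Heis b →ₗ⁅ℝ⁆ Module.End ℝ (S₀ × S₀)} (hρ : IsSpin ρ) :
    ∃ A C F : E →ₗ[ℝ] Module.End ℝ S₀,
      ∀ v, ρ (Heis.ofE b v) = block (A v) (C v) 0 (F v) := by
  obtain ⟨A, C, D, F, hT⟩ := exists_eq_linearBlock (ρ.toLinearMap ∘ₗ Heis.ofE b)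
  have hblock (v : E) : ρ (Heis.ofE b v) = block (A v) (C v) (D v) (F v) := LinearMap.congr_fun hT v
  have hD : D = 0 := e.toBasis.ext fun i => by
    obtain ⟨j, hj⟩ := exists_ne i
    have h := hρ.inner_smul_apply_p hb (e j) (e i)
    rw [e.inner_eq_zero hj, zero_smul, hblock, Ring.lie_def, block_mul, block_mul, block_sub,
      ← block_zero, block_inj] at h
    have hjD : vec S₀ (e j) * D (e i) = 0 := by simpa using h.1.symm
    rw [e.coe_toBasis, LinearMap.zero_apply, ← one_mul (D (e i)),
      ← (isCliffordFamily_vec S₀ e.orthonormal).mul_self j, mul_assoc, hjD, mul_zero]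
  exact ⟨A, C, F, fun v => by rw [hblock, hD, LinearMap.zero_apply]⟩

theorem IsSpin.exists_apply_p_eq {ι : Type*} [Fintype ι] [Nonempty ι]
    (e : OrthonormalBasis ι ℝ E) (hb : b.Nondegenerate)
    {ρ : Heis b →ₗ⁅ℝ⁆ Module.End ℝ (S₀ × S₀)} (hρ : IsSpin ρ)
    (hblock : ∀ v, ρ (Heis.ofE b v) = block (A v) (C v) 0 (F v)) :
    ∃ K, ρ (Heis.p b) = √2 • block 0 K 0 0 ∧
      ∀ u v : E, vec S₀ u * F v - A v * vec S₀ u = (inner ℝ u v : ℝ) • K := by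
  have hlie (u v : E) : (inner ℝ u v : ℝ) • ρ (Heis.p b) =
      √2 • block 0 (vec S₀ u * F v - A v * vec S₀ u) 0 0 := by
    rw [hρ.inner_smul_apply_p hb, hblock, Ring.lie_def, block_mul, block_mul, block_sub, smul_block]
    simp [smul_sub]
  have hone (i : ι) : (inner ℝ (e i) (e i) : ℝ) = 1 := by simp
  let i := Classical.arbitrary ι
  have hp := hlie (e i) (e i)
  rw [hone, one_smul] at hp
  refine ⟨_, hp, fun u v => ?_⟩
  have h := hlie u v
  rw [hp, smul_comm] at h
  have h := smul_right_injective _ (by positivity : √2 ≠ 0) h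
  rw [smul_block, block_inj] at h
  exact h.2.1.symm

theorem IsSpin.exists_isSpinDatum {ι : Type*} [Fintype ι] [Nontrivial ι]
    (e : OrthonormalBasis ι ℝ E) (hb : b.Nondegenerate)
    {ρ : Heis b →ₗ⁅ℝ⁆ Module.End ℝ (S₀ × S₀)} (hρ : IsSpin ρ) :
    ∃ A F C K, IsSpinDatum A F C K ∧ ρ (Heis.p b) = √2 • block 0 K 0 0 ∧
      ∀ v, ρ (Heis.ofE b v) = block (A v) (C v) 0 (F v) := by
  obtain ⟨A, C, F, hblock⟩ := hρ.exists_eq_block e hb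
  obtain ⟨K, hp, hint⟩ := hρ.exists_apply_p_eq e hb hblock
  have hEE (u v : E) := LieHom.map_lie ρ (Heis.ofE b u) (Heis.ofE b v)
  have hEp (v : E) := LieHom.map_lie ρ (Heis.ofE b v) (Heis.p b)
  simp only [Heis.lie_ofE_ofE, Heis.lie_ofE_p, map_zero, hblock, hp, Ring.lie_def, smul_block,
    block_mul, block_sub, ← block_zero (V := S₀), block_inj] at hEE hEp
  refine ⟨A, F, C, K, ⟨fun u v => ?_, fun u v => ?_, fun u v => ?_, hint, fun v => ?_⟩, hp, hblock⟩
  · exact sub_eq_zero.1 (by simpa using (hEE u v).1.symm)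
  · exact sub_eq_zero.1 (by simpa using (hEE u v).2.2.2.symm)
  · rw [sub_eq_sub_iff_add_eq_add, ← sub_eq_zero]
    exact (hEE u v).2.1.symm
  · exact sub_eq_zero.1 (by simpa [← smul_sub] using (hEp v).2.1.symm)

theorem IsSpinDatum.existsUnique_isSpin (h : IsSpinDatum A F C K) :
    ∃! ρ : Heis b →ₗ⁅ℝ⁆ Module.End ℝ (S₀ × S₀), IsSpin ρ ∧ ρ (Heis.p b) = √2 • block 0 K 0 0 ∧
      ∀ v, ρ (Heis.ofE b v) = block (A v) (C v) 0 (F v) := by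
  have hspin (u : E) : linearBlock 0 (√2 • vec S₀ ∘ₗ opB b) 0 0 u =
      spinRep S₀ (wedgeM (0, 1, 0) (opB b u, 0, 0)) := (spinRep_wedgeM _).symm
  simp only [IsSpin, ← hspin]
  refine Heis.existsUnique_lieHom b (R := linearBlock A C 0 F) (fun u v => ?_) (fun u v => ?_)
    (fun u v => ?_) (fun u => ?_) (fun v => ?_) <;>
  simp only [linearBlock_apply, Ring.lie_def, smul_block, block_mul, block_sub,
    ← block_zero (V := S₀), block_inj]
  · simp
  · have hs := h.suitable u v
    rw [sub_eq_sub_iff_add_eq_add] at hs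
    simp [(h.commute_left u v).eq, (h.commute_right u v).eq, hs]
  · have hi := h.intertwine (opB b u) v
    rw [inner_opB] at hi
    simp [smul_comm _ √2 K, ← hi, smul_sub]
  · simp
  · simp [h.central v]

end Correspondence

end SpinDatum

theorem exists_eq_smulRight {k W V : Type*} [Field k] [AddCommGroup W] [Module k W]
    [AddCommGroup V] [Module k V] {x : V} (hx : x ≠ 0) {T : W →ₗ[k] V}
    (hT : ∀ w, ∃ r : k, T w = r • x) : ∃ φ : Module.Dual k W, T = φ.smulRight x := by
  obtain ⟨g, hg⟩ := (LinearMap.toSpanSingleton k V x).exists_leftInverse_of_injective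
    (LinearMap.ker_toSpanSingleton k hx)
  refine ⟨g ∘ₗ T, LinearMap.ext fun w => ?_⟩
  obtain ⟨r, hr⟩ := hT w
  have hgr : g (r • x) = r := LinearMap.congr_fun hg r
  rw [LinearMap.smulRight_apply, LinearMap.comp_apply, hr, hgr]

section Classification

variable {E : Type*} [NormedAddCommGroup E] [InnerProductSpace ℝ E]
variable {S₀ : Type*} [AddCommGroup S₀] [Module ℝ S₀] [Module (ClE E) S₀]
  [IsScalarTower ℝ (ClE E) S₀]
variable {A F C : E →ₗ[ℝ] Module.End ℝ S₀} {K ε : Module.End ℝ S₀}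

theorem diagBlock_apply (c s : ℝ) (h₃ : Module.Dual ℝ E) (v : E) :
    diagBlock ε c s h₃ v = (1 / 2 : ℝ) • (h₃ v • 1 + c • vec S₀ v + s • (vec S₀ v * ε)) := rfl

section DiagonalBlocks

variable (hε : IsGradingOperator (vec (E := E) S₀) ε)
include hε

theorem IsGradingOperator.mul_vec (v : E) : ε * vec S₀ v = -(vec S₀ v * ε) := by
  rw [hε.anticomm, neg_neg]

theorem IsGradingOperator.mul_vec_mul (v : E) (X : Module.End ℝ S₀) :
    ε * (vec S₀ v * X) = -(vec S₀ v * (ε * X)) := by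
  rw [← mul_assoc, hε.mul_vec, neg_mul, mul_assoc]

theorem IsGradingOperator.commute_diagBlock {c s : ℝ} (hcs : c ^ 2 = s ^ 2)
    (h₃ : Module.Dual ℝ E) (u v : E) :
    Commute (diagBlock ε c s h₃ u) (diagBlock ε c s h₃ v) := by
  have hodd (u v : E) : (c • vec S₀ u + s • (vec S₀ u * ε)) * (c • vec S₀ v + s • (vec S₀ v * ε)) =
      (c ^ 2 - s ^ 2) • (vec S₀ u * vec S₀ v) := by
    simp only [mul_add, add_mul, smul_mul_assoc, mul_smul_comm, mul_assoc, hε.mul_vec,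
      hε.mul_vec_mul, hε.mul_self, mul_neg, smul_neg, mul_one]
    module
  have hcomm : Commute (c • vec S₀ u + s • (vec S₀ u * ε)) (c • vec S₀ v + s • (vec S₀ v * ε)) := by
    rw [Commute, SemiconjBy, hodd, hodd, hcs, sub_self, zero_smul, zero_smul]
  have hscalar (r : ℝ) (X : Module.End ℝ S₀) : Commute (r • 1) X := (Commute.one_left X).smul_left r
  simp only [diagBlock_apply, add_assoc]
  exact (((hscalar _ _).add_left (((hscalar _ _).symm).add_right hcomm)).smul_left _).smul_right _

theorem IsGradingOperator.vec_mul_diagBlock_sub (c s : ℝ) (h₃ : Module.Dual ℝ E) (u v : E) :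
    vec S₀ u * diagBlock ε c s h₃ v - diagBlock ε (-c) s h₃ v * vec S₀ u =
      (inner ℝ u v : ℝ) • (c • 1 + s • ε) := calc
  _ = (1 / 2 : ℝ) • ((vec S₀ u * vec S₀ v + vec S₀ v * vec S₀ u) * (c • 1 + s • ε)) := by
    simp only [diagBlock_apply, mul_add, add_mul, smul_mul_assoc, mul_smul_comm, one_mul,
      mul_one, mul_assoc, hε.mul_vec, mul_neg, smul_neg]
    module
  _ = (inner ℝ u v : ℝ) • (c • 1 + s • ε) := by
    rw [vec_mul_vec_add_swap, smul_mul_assoc, one_mul]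
    module

theorem IsGradingOperator.diagBlock_mul_sub (c s : ℝ) (h₃ : Module.Dual ℝ E) (v : E) :
    diagBlock ε (-c) s h₃ v * (c • 1 + s • ε) - (c • 1 + s • ε) * diagBlock ε c s h₃ v =
      (s ^ 2 - c ^ 2) • vec S₀ v := by
  simp only [diagBlock_apply, mul_add, add_mul, smul_mul_assoc, mul_smul_comm, one_mul,
    mul_one, mul_assoc, hε.mul_vec, hε.mul_vec_mul, hε.mul_self, smul_neg]
  module

theorem IsGradingOperator.isSpinDatum {c s : ℝ} (hcs : c ^ 2 = s ^ 2) {h₃ : Module.Dual ℝ E}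
    (hC : IsSuitable (diagBlock ε (-c) s h₃) (diagBlock ε c s h₃) C) :
    IsSpinDatum (diagBlock ε (-c) s h₃) (diagBlock ε c s h₃) C (c • 1 + s • ε) where
  commute_left := hε.commute_diagBlock (by rw [neg_sq, hcs]) h₃
  commute_right := hε.commute_diagBlock hcs h₃
  suitable := hC
  intertwine := hε.vec_mul_diagBlock_sub c s h₃
  central v := by
    rw [← sub_eq_zero, hε.diagBlock_mul_sub, hcs, sub_self, zero_smul]

end DiagonalBlocks

theorem IsSpinDatum.vec_mul_mul_vec_eq (h : IsSpinDatum A F C K) {ι : Type*} {e : ι → E}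
    (he : Orthonormal ℝ e) (i j : ι) :
    vec S₀ (e i) * K * vec S₀ (e i) = vec S₀ (e j) * K * vec S₀ (e j) := by
  obtain rfl | hij := eq_or_ne i j
  · rfl
  have hc := isCliffordFamily_vec S₀ he
  have hK : K = vec S₀ (e i) * F (e i) - A (e i) * vec S₀ (e i) := by
    rw [h.intertwine, real_inner_self_eq_norm_sq, he.norm_eq_one, one_pow, one_smul]
  have hint : vec S₀ (e j) * F (e i) = A (e i) * vec S₀ (e j) := by
    rw [← sub_eq_zero, h.intertwine, he.inner_eq_zero hij.symm, zero_smul]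
  have hF : F (e i) = vec S₀ (e j) * A (e i) * vec S₀ (e j) := by
    rw [mul_assoc, ← hint, hc.mul_mul_self]
  have hA : A (e i) = vec S₀ (e j) * F (e i) * vec S₀ (e j) := by
    rw [hint, mul_assoc, hc.mul_self, mul_one]
  calc vec S₀ (e i) * K * vec S₀ (e i)
      = F (e i) * vec S₀ (e i) - vec S₀ (e i) * A (e i) := by
        rw [hK]
        simp only [mul_sub, sub_mul, mul_assoc, hc.mul_mul_self, hc.mul_self, mul_one]
    _ = vec S₀ (e j) * A (e i) * (vec S₀ (e j) * vec S₀ (e i)) -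
          vec S₀ (e i) * vec S₀ (e j) * F (e i) * vec S₀ (e j) := by
        rw [hF, hA]
        simp only [mul_assoc, hc.mul_mul_self, hc.mul_self, mul_one]
    _ = vec S₀ (e j) * K * vec S₀ (e j) := by
        have hanti := hc.anticomm j i hij.symm
        rw [hanti, hK, mul_sub, ← mul_assoc (vec S₀ (e j)) (vec S₀ (e i)), hanti]
        noncomm_ring

theorem IsSpinDatum.exists_eq_diagBlock_add (h : IsSpinDatum A F C K)
    (hε : IsGradingOperator (vec (E := E) S₀) ε) {ι : Type*} {e : ι → E} (he : Orthonormal ℝ e)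
    (hcent : HasScalarCommutant ℝ fun i => vec S₀ (e i)) {c s : ℝ} (hK : K = c • 1 + s • ε)
    (v : E) : ∃ α β : ℝ, F v = diagBlock ε c s 0 v + (α • 1 + β • ε) ∧
      A v = diagBlock ε (-c) s 0 v + (α • 1 - β • ε) := by
  have hint (u : E) : vec S₀ u * (F v - diagBlock ε c s 0 v) =
      (A v - diagBlock ε (-c) s 0 v) * vec S₀ u := by
    have hdiag := hε.vec_mul_diagBlock_sub c s 0 u v
    rw [← hK, ← h.intertwine] at hdiag
    rw [mul_sub, sub_mul, sub_eq_sub_iff_sub_eq_sub, hdiag]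
  have hc := isCliffordFamily_vec S₀ he
  obtain ⟨α, β, hF, hA⟩ := (hε.comp e).exists_eq_smul_one_add_smul hc hcent
    (X := F v - diagBlock ε c s 0 v) (Y := A v - diagBlock ε (-c) s 0 v)
    fun i => by rw [hint, mul_assoc, hc.mul_self, mul_one]
  exact ⟨α, β, (sub_eq_iff_eq_add'.1 hF), (sub_eq_iff_eq_add'.1 hA)⟩

theorem IsGradingOperator.vec_eq_zero_of_eq_smul_one_add_smul
    (hε : IsGradingOperator (vec (E := E) S₀) ε) {v : E} {α β : ℝ}
    (h : vec S₀ v = α • 1 + β • ε) : vec S₀ v = 0 := by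
  have : IsAddTorsionFree (Module.End ℝ S₀) := .of_isTorsionFree ℝ _
  have hcomm : vec S₀ v * ε = ε * vec S₀ v := by simp [h, add_mul, mul_add]
  have hzero : vec S₀ v * ε = 0 := self_eq_neg.1 ((hε.anticomm v).trans (by rw [hcomm]))
  rw [← mul_one (vec S₀ v), ← hε.mul_self, ← mul_assoc, hzero, zero_mul]

theorem IsSpinDatum.exists_eq_diagBlock_add_smul_one [Nontrivial S₀] (h : IsSpinDatum A F C K)
    (hK0 : K ≠ 0) (hε : IsGradingOperator (vec (E := E) S₀) ε) {ι : Type*} [Nonempty ι] {e : ι → E}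
    (he : Orthonormal ℝ e) (hcent : HasScalarCommutant ℝ fun i => vec S₀ (e i)) {c s : ℝ}
    (hK : K = c • 1 + s • ε) (v : E) :
    vec S₀ ((s ^ 2 - c ^ 2) • v) = 0 ∧
      ∃ α : ℝ, F v = diagBlock ε c s 0 v + α • 1 ∧ A v = diagBlock ε (-c) s 0 v + α • 1 := by
  obtain ⟨α, β, hF, hA⟩ := h.exists_eq_diagBlock_add hε he hcent hK v
  have hodd : vec S₀ ((s ^ 2 - c ^ 2) • v) = (2 * β * s) • 1 + (2 * β * c) • ε := by
    have hcen := h.central v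
    rw [hF, hA, ← sub_eq_zero, add_mul, mul_add, add_sub_add_comm, hK,
      hε.diagBlock_mul_sub] at hcen
    rw [map_smul, eq_neg_of_add_eq_zero_left hcen]
    simp only [mul_add, add_mul, sub_mul, smul_mul_smul_comm, one_mul, mul_one, hε.mul_self]
    module
  have hzero := hε.vec_eq_zero_of_eq_smul_one_add_smul hodd
  obtain ⟨hs, hc⟩ := (hε.comp e).smul_one_add_smul_eq_zero (isCliffordFamily_vec S₀ he)
    (Classical.arbitrary ι) (hodd.symm.trans hzero)
  have hβ : β = 0 := by
    by_contra hβ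
    refine hK0 ?_
    rw [hK, (mul_eq_zero_iff_left (by simpa using hβ)).1 hs,
      (mul_eq_zero_iff_left (by simpa using hβ)).1 hc, zero_smul, zero_smul, add_zero]
  exact ⟨hzero, α, by rw [hF, hβ, zero_smul, add_zero], by rw [hA, hβ, zero_smul, sub_zero]⟩

theorem IsSpinDatum.exists_eq_diagBlock [Nontrivial S₀] (h : IsSpinDatum A F C K)
    (hK0 : K ≠ 0) (hε : IsGradingOperator (vec (E := E) S₀) ε) {ι : Type*} [Nonempty ι] {e : ι → E}
    (he : Orthonormal ℝ e) (hcent : HasScalarCommutant ℝ fun i => vec S₀ (e i)) :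
    ∃ (c s : ℝ) (h₃ : Module.Dual ℝ E), c ^ 2 = s ^ 2 ∧ K = c • 1 + s • ε ∧
      A = diagBlock ε (-c) s h₃ ∧ F = diagBlock ε c s h₃ := by
  have hc := isCliffordFamily_vec S₀ he
  let i := Classical.arbitrary ι
  obtain ⟨c, s, hK, -⟩ := (hε.comp e).exists_eq_smul_one_add_smul hc hcent
    fun j => h.vec_mul_mul_vec_eq he j i
  have hblock := h.exists_eq_diagBlock_add_smul_one hK0 hε he hcent hK
  have hcs : c ^ 2 = s ^ 2 := by
    have hzero := (hblock (e i)).1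
    have hne : vec S₀ (e i) ≠ 0 := left_ne_zero_of_mul_eq_one (hc.mul_self i)
    rw [map_smul, smul_eq_zero_iff_left hne, sub_eq_zero] at hzero
    exact hzero.symm
  choose α hF hA using fun v => (hblock v).2
  obtain ⟨φ, hφ⟩ := exists_eq_smulRight (T := F - diagBlock ε c s 0) one_ne_zero
    fun v => ⟨α v, sub_eq_iff_eq_add'.2 (hF v)⟩
  have hα (v : E) : α v • (1 : Module.End ℝ S₀) = φ v • 1 :=
    (sub_eq_iff_eq_add'.2 (hF v)).symm.trans (LinearMap.congr_fun hφ v)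
  have hdiag (c : ℝ) (v : E) :
      diagBlock ε c s ((2 : ℝ) • φ) v = diagBlock ε c s 0 v + φ v • 1 := by
    simp only [diagBlock_apply, LinearMap.smul_apply, LinearMap.zero_apply, smul_eq_mul]
    module
  exact ⟨c, s, (2 : ℝ) • φ, hcs, hK, LinearMap.ext fun v => by rw [hA, hα, hdiag],
    LinearMap.ext fun v => by rw [hF, hα, hdiag]⟩

end Classification

section MainResults

variable {E : Type*} [NormedAddCommGroup E] [InnerProductSpace ℝ E] [FiniteDimensional ℝ E]
variable {S₀ : Type*} [AddCommGroup S₀] [Module ℝ S₀] [Module (ClE E) S₀]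
  [IsScalarTower ℝ (ClE E) S₀]
variable {b : LinearMap.BilinForm ℝ E} {ε : Module.End ℝ S₀}

theorem IsSpin.exists_eq_block_diagBlock [Nontrivial S₀] {ι : Type*} [Fintype ι] [Nontrivial ι]
    (e : OrthonormalBasis ι ℝ E) (hcent : HasScalarCommutant ℝ fun i => vec S₀ (e i))
    (hε : IsGradingOperator (vec (E := E) S₀) ε) (hb : b.Nondegenerate)
    {ρ : Heis b →ₗ⁅ℝ⁆ Module.End ℝ (S₀ × S₀)} (hρ : IsSpin ρ) (hρp : ρ (Heis.p b) ≠ 0) :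
    ∃ (s h₁ : ℝ) (h₃ : Module.Dual ℝ E) (C : E →ₗ[ℝ] Module.End ℝ S₀),
      (s = 1 ∨ s = -1) ∧ h₁ ≠ 0 ∧
      IsSuitable (diagBlock ε (-h₁) (s * h₁) h₃) (diagBlock ε h₁ (s * h₁) h₃) C ∧
      ρ (Heis.p b) = √2 • block 0 (h₁ • (1 + s • ε)) 0 0 ∧
      ∀ v : E, ρ (Heis.ofE b v) =
        block (diagBlock ε (-h₁) (s * h₁) h₃ v) (C v) 0 (diagBlock ε h₁ (s * h₁) h₃ v) := by
  obtain ⟨A, F, C, K, hdatum, hp, hE⟩ := hρ.exists_isSpinDatum e hb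
  have hK0 : K ≠ 0 := by
    rintro rfl
    exact hρp (by rw [hp, block_zero, smul_zero])
  obtain ⟨h₁, t, h₃, hsq, rfl, rfl, rfl⟩ := hdatum.exists_eq_diagBlock hK0 hε e.orthonormal hcent
  obtain ⟨s, hs, rfl⟩ : ∃ s : ℝ, (s = 1 ∨ s = -1) ∧ t = s * h₁ := by
    obtain h | h := sq_eq_sq_iff_eq_or_eq_neg.1 hsq.symm
    · exact ⟨1, .inl rfl, by rw [h, one_mul]⟩
    · exact ⟨-1, .inr rfl, by rw [h, neg_one_mul]⟩
  have hh₁ : h₁ ≠ 0 := by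
    rintro rfl
    exact hK0 (by simp)
  exact ⟨s, h₁, h₃, C, hs, hh₁, hdatum.suitable, by rw [hp, smul_add, smul_smul, mul_comm s], hE⟩

theorem IsGradingOperator.existsUnique_isSpin [Nontrivial S₀] {ι : Type*} [Nonempty ι] {e : ι → E}
    (he : Orthonormal ℝ e) (hε : IsGradingOperator (vec (E := E) S₀) ε) {s h₁ : ℝ}
    {h₃ : Module.Dual ℝ E} {C : E →ₗ[ℝ] Module.End ℝ S₀} (hs : s = 1 ∨ s = -1) (hh₁ : h₁ ≠ 0)
    (hC : IsSuitable (diagBlock ε (-h₁) (s * h₁) h₃) (diagBlock ε h₁ (s * h₁) h₃) C) :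
    ∃! ρ : Heis b →ₗ⁅ℝ⁆ Module.End ℝ (S₀ × S₀),
      IsSpin ρ ∧ ρ (Heis.p b) ≠ 0 ∧
      ρ (Heis.p b) = √2 • block 0 (h₁ • (1 + s • ε)) 0 0 ∧
      ∀ v : E, ρ (Heis.ofE b v) =
        block (diagBlock ε (-h₁) (s * h₁) h₃ v) (C v) 0 (diagBlock ε h₁ (s * h₁) h₃ v) := by
  have hK : h₁ • (1 + s • ε) = h₁ • (1 : Module.End ℝ S₀) + (s * h₁) • ε := by
    rw [smul_add, smul_smul, mul_comm]
  have hsq : h₁ ^ 2 = (s * h₁) ^ 2 := by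
    obtain rfl | rfl := hs <;> ring
  have hp0 : √2 • block 0 (h₁ • (1 + s • ε)) 0 0 ≠ 0 := by
    rw [← block_zero, smul_block, Ne, block_inj, hK]
    rintro ⟨-, h, -⟩
    exact hh₁ ((hε.comp e).smul_one_add_smul_eq_zero (isCliffordFamily_vec S₀ he)
      (Classical.arbitrary ι) ((smul_eq_zero_iff_right (by positivity)).1 h)).1
  obtain ⟨ρ, ⟨hspin, hp, hE⟩, huniq⟩ := (hε.isSpinDatum hsq hC).existsUnique_isSpin (b := b)
  rw [← hK] at hp huniq
  exact ⟨ρ, ⟨hspin, hp ▸ hp0, hp, hE⟩, fun ρ' ⟨hspin', _, hp', hE'⟩ => huniq ρ' ⟨hspin', hp', hE'⟩⟩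

end MainResults

theorem theorem2p16_general {E S₀ : Type*}
    [NormedAddCommGroup E] [InnerProductSpace ℝ E] [FiniteDimensional ℝ E]
    [AddCommGroup S₀] [Module ℝ S₀] [Module (ClE E) S₀] [IsScalarTower ℝ (ClE E) S₀]
    [IsSimpleModule (ClE E) S₀] {m : ℕ} [NeZero m] (hm : 8 ∣ m)
    (e : OrthonormalBasis (Fin m) ℝ E) (b : LinearMap.BilinForm ℝ E) :
    (cliff S₀ (volumeElement e) ∈ schurAlgebra E S₀ ∧
      IsParaComplex (cliff S₀ (volumeElement e))) ∧
    ∀ 𝓔 ∈ schurAlgebra E S₀, IsParaComplex 𝓔 →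
      (b.Nondegenerate → ∀ ρ : Heis b →ₗ⁅ℝ⁆ Module.End ℝ (S₀ × S₀),
        IsSpin ρ → ρ (Heis.p b) ≠ 0 →
        ∃ (s h₁ : ℝ) (h₃ : Module.Dual ℝ E) (ρ₁₂ : E →ₗ[ℝ] Module.End ℝ S₀),
          (s = 1 ∨ s = -1) ∧ h₁ ≠ 0 ∧
          IsSuitable (diagBlock 𝓔 (-h₁) (s * h₁) h₃) (diagBlock 𝓔 h₁ (s * h₁) h₃) ρ₁₂ ∧
          ρ (Heis.p b) = √2 • block 0 (h₁ • (1 + s • 𝓔)) 0 0 ∧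
          ∀ v : E, ρ (Heis.ofE b v) =
            block (diagBlock 𝓔 (-h₁) (s * h₁) h₃ v) (ρ₁₂ v)
              0 (diagBlock 𝓔 h₁ (s * h₁) h₃ v)) ∧
      (∀ (s h₁ : ℝ) (h₃ : Module.Dual ℝ E) (ρ₁₂ : E →ₗ[ℝ] Module.End ℝ S₀),
          (s = 1 ∨ s = -1) → h₁ ≠ 0 →
          IsSuitable (diagBlock 𝓔 (-h₁) (s * h₁) h₃) (diagBlock 𝓔 h₁ (s * h₁) h₃) ρ₁₂ →
        ∃! ρ : Heis b →ₗ⁅ℝ⁆ Module.End ℝ (S₀ × S₀),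
          IsSpin ρ ∧ ρ (Heis.p b) ≠ 0 ∧
          ρ (Heis.p b) = √2 • block 0 (h₁ • (1 + s • 𝓔)) 0 0 ∧
          ∀ v : E, ρ (Heis.ofE b v) =
            block (diagBlock 𝓔 (-h₁) (s * h₁) h₃ v) (ρ₁₂ v)
              0 (diagBlock 𝓔 h₁ (s * h₁) h₃ v)) := by
  have : Nontrivial S₀ := IsSimpleModule.nontrivial (ClE E) S₀
  have : Nontrivial (Fin m) :=
    Fin.nontrivial_iff_two_le.2 (le_trans (by norm_num) (Nat.le_of_dvd (NeZero.pos m) hm))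
  have hm4 : 4 ∣ m := dvd_trans (by norm_num) hm
  have hcent := hasScalarCommutant_vec S₀ e (by rwa [Fintype.card_fin])
  refine ⟨⟨(isGradingOperator_cliff_volumeElement S₀ hm4 e).mem_schurAlgebra,
    isParaComplex_cliff_volumeElement hm4 e⟩, fun 𝓔 hmem h𝓔 => ?_⟩
  have hgrad := h𝓔.isGradingOperator_of_mem_schurAlgebra hm e hmem
  exact ⟨fun hb _ hρ hρp => hρ.exists_eq_block_diagBlock e hcent hgrad hb hρp,
    fun _ _ _ _ hs hh₁ hC => hgrad.existsUnique_isSpin e.orthonormal hs hh₁ hC⟩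

end CahenWallach

open CahenWallach in
theorem theorem2p16 {E S₀ : Type*}
    [NormedAddCommGroup E] [InnerProductSpace ℝ E] [FiniteDimensional ℝ E]
    [AddCommGroup S₀] [Module ℝ S₀] [Module (ClE E) S₀] [IsScalarTower ℝ (ClE E) S₀]
    [IsSimpleModule (ClE E) S₀]
    (n : ℕ) (hn : 2 ≤ n) (hmod : n - 1 ≡ 0 [MOD 8])
    (basis : OrthonormalBasis (Fin (n - 1)) ℝ E)
    (b : LinearMap.BilinForm ℝ E) (hsymm : b.IsSymm) (hnd : b.Nondegenerate) :
    -- the volume element acts as a para-complex structure in the Schur algebra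
    (cliff S₀ (volumeElement basis) ∈ schurAlgebra E S₀ ∧
      IsParaComplex (cliff S₀ (volumeElement basis))) ∧
    ∀ 𝓔 ∈ schurAlgebra E S₀, IsParaComplex 𝓔 →
      -- every spin representation of non-zero charge is given by the formula
      (∀ ρ : Heis b →ₗ⁅ℝ⁆ Module.End ℝ (S₀ × S₀), IsSpin ρ → ρ (Heis.p b) ≠ 0 →
        ∃ (s h₁ : ℝ) (h₃ : Module.Dual ℝ E) (ρ₁₂ : E →ₗ[ℝ] Module.End ℝ S₀),
          (s = 1 ∨ s = -1) ∧ h₁ ≠ 0 ∧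
          IsSuitable (diagBlock 𝓔 (-h₁) (s * h₁) h₃) (diagBlock 𝓔 h₁ (s * h₁) h₃) ρ₁₂ ∧
          ρ (Heis.p b) = √2 • block 0 (h₁ • (1 + s • 𝓔)) 0 0 ∧
          ∀ e : E, ρ (Heis.ofE b e) =
            block (diagBlock 𝓔 (-h₁) (s * h₁) h₃ e) (ρ₁₂ e)
              0 (diagBlock 𝓔 h₁ (s * h₁) h₃ e)) ∧
      -- and the formula always defines a spin representation of non-zero charge
      (∀ (s h₁ : ℝ) (h₃ : Module.Dual ℝ E) (ρ₁₂ : E →ₗ[ℝ] Module.End ℝ S₀),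
          (s = 1 ∨ s = -1) → h₁ ≠ 0 →
          IsSuitable (diagBlock 𝓔 (-h₁) (s * h₁) h₃) (diagBlock 𝓔 h₁ (s * h₁) h₃) ρ₁₂ →
        ∃! ρ : Heis b →ₗ⁅ℝ⁆ Module.End ℝ (S₀ × S₀),
          IsSpin ρ ∧ ρ (Heis.p b) ≠ 0 ∧
          ρ (Heis.p b) = √2 • block 0 (h₁ • (1 + s • 𝓔)) 0 0 ∧
          ∀ e : E, ρ (Heis.ofE b e) =
            block (diagBlock 𝓔 (-h₁) (s * h₁) h₃ e) (ρ₁₂ e)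
              0 (diagBlock 𝓔 h₁ (s * h₁) h₃ e)) := by
  have : NeZero (n - 1) := ⟨by omega⟩
  have h := theorem2p16_general (S₀ := S₀) (Nat.modEq_zero_iff_dvd.1 hmod) basis b
  exact ⟨h.1, fun 𝓔 hmem h𝓔 => (h.2 𝓔 hmem h𝓔).imp_left (· hnd)⟩
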